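/- Let $\Bbbk$ be an algebraically closed field of characteristic $0$, let $G$ be a finite group with identity $e$, and let $\omega\colon G^3\to\Bbbk^\times$ be a normalized $3$-cocycle, i.e. $\omega(a,e,b)=1$ and $$\omega(ab,c,d)\,\omega(a,b,cd)=\omega(a,b,c)\,\omega(a,bc,d)\,\omega(b,c,d).$$ Let $K,L\le G$ be subgroups and let $\beta\colon K^2\to\Bbbk^\times$, $\psi\colon L^2\to\Bbbk^\times$ be normalized $2$-cochains (value $1$ if an argument is $e$) with $d\beta=\omega|_{K^3}$, $d\psi=\omega|_{L^3}$, where $d\theta=\omega$ means $\theta(a,bc)\,\theta(b,c)=\omega(a,b,c)\,\theta(ab,c)\,\theta(a,b)$. Let $\mathsf{Vec}_G^\omega$ be the monoidal category of finite-dimensional $G$-graded $\Bbbk$-vector spaces, with the usual graded tensor product, the usual unit constraints, and associativity constraint $\omega^{-1}(a,b,c)\colon(\delta_a\otimes\delta_b)\otimes\delta_c\to\delta_a\otimes(\delta_b\otimes\delta_c)$, where $\delta_g$ is the one-dimensional space in degree $g$; we also write $\delta_g$ for its basis vector. For $N\in\{K,L\}$ and the corresponding cochain $\theta\in\{\beta,\psi\}$,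 let $A(N,\theta)=\bigoplus_{g\in N}\delta_g$ with $m(\delta_g\otimes\delta_{g'})=\theta(g,g')\delta_{gg'}$, $u(\delta_e)=\delta_e$, $\Delta(\delta_g)=|N|^{-1}\sum_{h\in N}\theta^{-1}(gh,h^{-1})\,\delta_{gh}\otimes\delta_{h^{-1}}$, $\varepsilon(\delta_g)=|N|\,\delta_{g,e}\,\delta_e$. Put $A=A(K,\beta)$ and $B=A(L,\psi)$. Let $\mathcal C=\mathcal C(G,\omega,K,\beta)$ be the monoidal category of $A$-bimodules in $\mathsf{Vec}_G^\omega$, with tensor product $\otimes_A$ and unit object $A$; let $\pi\colon M\otimes N\to M\otimes_A N$ be the projection. Let $\Phi\colon\mathsf{Vec}_G^\omega\to\mathcal C$, $\Phi(X)=(A\otimes X)\otimes A$, $\Phi(\varphi)=(\mathrm{id}_A\otimes\varphi)\otimes\mathrm{id}_A$, be the free bimodule functor, with actions given by the multiplication of $A$ on the outer factors. Let $\widetilde\Phi_{X,Y}\colon\Phi(X)\otimes\Phi(Y)\to\Phi(X\otimes Y)$ be the map that, after reassociating, applies $\varepsilon_A m_A$ to the two inner copies of $A$; let $\widetilde\Phi^{X,Y}\colon\Phi(X\otimes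 Y)\to\Phi(X)\otimes\Phi(Y)$ be the map that inserts $\Delta_A u_A$ between $X$ and $Y$ (and reassociates); let $\Phi_0=(r_A^{-1}\otimes\mathrm{id}_A)\Delta_A\colon A\to\Phi(\mathbb 1)$ and $\Phi^0=m_A(r_A\otimes\mathrm{id}_A)\colon\Phi(\mathbb 1)\to A$, where $r_A\colon A\otimes\mathbb 1\to A$ is the right unit constraint. **Theorem.** The underlying object of the twisted Hecke algebra $A^{K,\beta}(L,\psi):=\Phi(A(L,\psi))\in\mathcal C$ is the direct sum $$\bigoplus_{g\in L;\ f,k\in K}(\delta_f\otimes\delta_g)\otimes\delta_k ,$$ and $A^{K,\beta}(L,\psi)$ is a Frobenius algebra in $\mathcal C$ (an algebra and a coalgebra with $(m\otimes_A\mathrm{id})\,\alpha^{-1}(\mathrm{id}\otimes_A\Delta)=\Delta m=(\mathrm{id}\otimes_A m)\,\alpha\,(\Delta\otimes_A\mathrm{id})$, where $\alpha$ is the associativity constraint of $\mathcal C$) with structure morphisms given, for $f,f',k,k',d\in K$ and $g,g'\in L$, by $$\begin{aligned} m\big[((\delta_f\otimes\delta_g)\otimes\delta_k)\otimes_A((\delta_{f'}\otimes\delta_{g'})\otimes\delta_{k'})\big]={}&\delta_{kf',e}\,\omega(fgk,f'g',k')\,\omega^{-1}(fg,k,f'g')\,\omega(k,f',g')\,\omega^{-1}(f,g,g')\\&\cdot\beta(k,f')\,\psi(g,g')\,(\delta_f\otimes\delta_{gg'})\otimes\delta_{k'},\\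 u(\delta_d)={}&\sum_{s\in K}\beta^{-1}(ds^{-1},s)\,(\delta_{ds^{-1}}\otimes\delta_e)\otimes\delta_s,\\ \Delta\big[(\delta_f\otimes\delta_g)\otimes\delta_k\big]={}&|K|^{-1}|L|^{-1}\sum_{h\in L,\,s\in K}\omega(f,gh,h^{-1})\,\omega(fgh,s,s^{-1}h^{-1})\,\omega^{-1}(fghs,s^{-1}h^{-1},k)\\&\cdot\omega^{-1}(s,s^{-1},h^{-1})\,\psi^{-1}(gh,h^{-1})\,\beta^{-1}(s,s^{-1})\\&\cdot((\delta_f\otimes\delta_{gh})\otimes\delta_s)\otimes_A((\delta_{s^{-1}}\otimes\delta_{h^{-1}})\otimes\delta_k),\\ \varepsilon\big[(\delta_f\otimes\delta_g)\otimes\delta_k\big]={}&\delta_{g,e}\,|L|\,\beta(f,k)\,\delta_{fk}. \end{aligned}$$ Moreover, these morphisms are the ones that $\Phi$ induces from the Frobenius structures of $A$ and $B$ above, up to a normalization of $m$ and $u$: $$m\,\pi=|K|^{-1}\,\Phi(m_B)\,\widetilde\Phi_{B,B},\quad u=|K|\,\Phi(u_B)\,\Phi_0,\quad \Delta=\pi\,\widetilde\Phi^{B,B}\,\Phi(\Delta_B),\quad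 \varepsilon=\Phi^0\,\Phi(\varepsilon_B).$$ -/

import Mathlib

open CategoryTheory MonoidalCategory Limits
open scoped TensorProduct

universe u

set_option linter.unusedSectionVars false
set_option linter.unusedSimpArgs false

namespace TwistedHecke

noncomputable section

/-- A normalized 3-cocycle on `G` with values in `kˣ` (trivial action). For a cocycle, the value `1`
at `(g, 1, h)` for all `g, h` forces the value `1` whenever one of the arguments is `1`. -/
structure Cocycle3 (k G : Type u) [Field k] [Group G] where
  toFun : G → G → G → kˣ
  cocycle : ∀ a b c d, toFun (a * b) c d * toFun a b (c * d) =
    toFun a b c * toFun a (b * c) d * toFun b c d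
  normalized : ∀ a b, toFun a 1 b = 1

/-- A normalized 2-cochain on the subgroup `L` whose coboundary is the restriction of `ω`
to `L`. -/
structure Cochain2 {k G : Type u} [Field k] [Group G] (ω : Cocycle3 k G) (L : Subgroup G) where
  toFun : L → L → kˣ
  one_left : ∀ g, toFun 1 g = 1
  one_right : ∀ g, toFun g 1 = 1
  coboundary : ∀ a b c : L, toFun a (b * c) * toFun b c =
    ω.toFun a b c * toFun (a * b) c * toFun a b

instance {k G : Type u} [Field k] [Group G] :
    CoeFun (Cocycle3 k G) (fun _ => G → G → G → kˣ) := ⟨Cocycle3.toFun⟩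

instance {k G : Type u} [Field k] [Group G] (ω : Cocycle3 k G) (L : Subgroup G) :
    CoeFun (Cochain2 ω L) (fun _ => L → L → kˣ) := ⟨Cochain2.toFun⟩

section Vec

variable {k G : Type u} [Field k] [Group G] [Fintype G] [DecidableEq G]

theorem Cocycle3.one_left (ω : Cocycle3 k G) (a b : G) : ω 1 a b = 1 := by
  have h1 := ω.cocycle 1 1 a b
  simp only [one_mul, ω.normalized, mul_one, mul_left_cancel_iff] at h1
  simpa using h1.symm

theorem Cocycle3.one_right (ω : Cocycle3 k G) (a b : G) : ω a b 1 = 1 := by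
  have h1 := ω.cocycle a b 1 1
  simp only [mul_one, ω.normalized] at h1
  simpa using h1.symm

/-- A finite-dimensional `G`-graded `k`-vector space. The grading is recorded by the projections
`proj g` onto the homogeneous components, which are the ranges of these idempotents.
(The parameter `ω` only serves to select the associativity constraint.) -/
structure Vec (ω : Cocycle3 k G) where
  V : Type u
  [addCommGroup : AddCommGroup V]
  [module : Module k V]
  [finite : Module.Finite k V]
  proj : G → Module.End k V
  isGrading : CompleteOrthogonalIdempotents proj

attribute [instance] Vec.addCommGroup Vec.module Vec.finite

namespace Vec

variable {ω : Cocycle3 k G}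

/-- The vector `x` is homogeneous of degree `a`. -/
def Homog (X : Vec ω) (a : G) (x : X.V) : Prop := X.proj a x = x

theorem proj_proj (X : Vec ω) (a b : G) (x : X.V) :
    X.proj a (X.proj b x) = if a = b then X.proj b x else 0 := by
  split_ifs with h
  · subst h
    exact LinearMap.congr_fun (X.isGrading.idem a).eq x
  · exact LinearMap.congr_fun (X.isGrading.ortho h) x

theorem homog_proj (X : Vec ω) (a : G) (x : X.V) : X.Homog a (X.proj a x) := by
  simp [Homog, proj_proj]

theorem Homog.proj_eq {X : Vec ω} {a : G} {x : X.V} (h : X.Homog a x) (b : G) :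
    X.proj b x = if b = a then x else 0 := by
  have := X.proj_proj b a x
  rwa [h] at this

theorem sum_proj (X : Vec ω) (x : X.V) : ∑ a, X.proj a x = x := by
  have := LinearMap.congr_fun X.isGrading.complete x
  simpa using this

theorem ext1 {X : Vec ω} {M : Type u} [AddCommGroup M] [Module k M] {f g : X.V →ₗ[k] M}
    (h : ∀ a x, X.Homog a x → f x = g x) : f = g := by
  ext x
  rw [← X.sum_proj x, map_sum, map_sum]
  exact Finset.sum_congr rfl fun a _ => h a _ (X.homog_proj a x)

/-- A morphism of graded vector spaces is a linear map preserving the grading. -/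
@[ext]
structure Hom (X Y : Vec ω) where
  hom : X.V →ₗ[k] Y.V
  comm : ∀ g, hom ∘ₗ X.proj g = Y.proj g ∘ₗ hom

instance : Category (Vec ω) where
  Hom X Y := Hom X Y
  id X := ⟨LinearMap.id, fun _ => rfl⟩
  comp f g := ⟨g.hom ∘ₗ f.hom, fun a => by
    rw [LinearMap.comp_assoc, f.comm, ← LinearMap.comp_assoc, g.comm, LinearMap.comp_assoc]⟩

@[ext]
theorem hom_ext {X Y : Vec ω} {f g : X ⟶ Y} (h : f.hom = g.hom) : f = g := Hom.ext h

@[simp] theorem id_hom (X : Vec ω) : (𝟙 X : X ⟶ X).hom = LinearMap.id := rfl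

@[simp] theorem comp_hom {X Y Z : Vec ω} (f : X ⟶ Y) (g : Y ⟶ Z) :
    (f ≫ g).hom = g.hom ∘ₗ f.hom := rfl

theorem Homog.map {X Y : Vec ω} (f : X ⟶ Y) {a : G} {x : X.V} (h : X.Homog a x) :
    Y.Homog a (f.hom x) := by
  have := LinearMap.congr_fun (f.comm a) x
  simp only [LinearMap.comp_apply] at this
  rw [Homog, ← this, h]

/-- A linear map sending homogeneous vectors of degree `a` to such vectors is a morphism. -/
theorem comm_of_homog {X Y : Vec ω} (f : X.V →ₗ[k] Y.V)
    (h : ∀ a x, X.Homog a x → Y.Homog a (f x)) (g : G) : f ∘ₗ X.proj g = Y.proj g ∘ₗ f := by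
  apply ext1
  intro a x hx
  simp only [LinearMap.comp_apply, hx.proj_eq, (h a x hx).proj_eq]
  split_ifs <;> simp

/-- The one-dimensional graded vector space concentrated in degree `g`. -/
abbrev δ (ω : Cocycle3 k G) (g : G) : Vec ω where
  V := k
  proj x := if x = g then LinearMap.id else 0
  isGrading := by
    rw [CompleteOrthogonalIdempotents.iff_ortho_complete]
    refine ⟨fun a b hab => ?_, ?_⟩
    · dsimp only
      split_ifs with h1 h2
      · exact absurd (h1.trans h2.symm) hab
      all_goals simp
    · simp only [Finset.sum_ite_eq', Finset.mem_univ, if_true]; rfl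

/-- For a finite family `d` of degrees, the direct sum of the spaces `δ (d s)`, realized with
basis `Finsupp.single s 1`, the vector indexed by `s` being of degree `d s`. -/
abbrev ofDegrees (ω : Cocycle3 k G) {S : Type u} [Finite S] (d : S → G) : Vec ω where
  V := S →₀ k
  proj x := Finsupp.lsum k fun s => if d s = x then Finsupp.lsingle s else 0
  isGrading := by
    rw [CompleteOrthogonalIdempotents.iff_ortho_complete]
    refine ⟨fun a b hab => ?_, ?_⟩
    · ext s : 2
      by_cases h : d s = b
      · have : d s ≠ a := fun h' => hab (h'.symm.trans h)
        simp [h, hab.symm]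
      · simp [h]
    · refine Finsupp.lhom_ext fun s c => ?_
      rw [LinearMap.sum_apply]
      simp only [Finsupp.lsum_single]
      rw [Finset.sum_eq_single (d s)]
      · simp
      · intro b _ hb
        simp [hb.symm]
      · simp

/-- The tensor product, with `(X ⊗ Y)_x = ⨁_{y z = x} X_y ⊗ Y_z`. -/
abbrev tens (X Y : Vec ω) : Vec ω where
  V := X.V ⊗[k] Y.V
  proj x := ∑ y, TensorProduct.map (X.proj y) (Y.proj (y⁻¹ * x))
  isGrading := by
    rw [CompleteOrthogonalIdempotents.iff_ortho_complete]
    refine ⟨fun a b hab => ?_, ?_⟩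
    · dsimp only
      rw [Finset.sum_mul_sum]
      refine Finset.sum_eq_zero fun y _ => Finset.sum_eq_zero fun z _ => ?_
      rw [← TensorProduct.map_mul]
      by_cases h : y = z
      · subst h
        rw [X.isGrading.idem y, X.isGrading.toOrthogonalIdempotents.idem y |>.eq.symm]
        rw [Y.isGrading.ortho (fun h => hab (mul_left_cancel h))]
        simp
      · rw [X.isGrading.ortho h]
        simp
    · rw [Finset.sum_comm]
      have h1 : ∀ y : G, ∑ x, TensorProduct.map (X.proj y) (Y.proj (y⁻¹ * x)) =
          TensorProduct.map (X.proj y) 1 := by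
        intro y
        rw [← Y.isGrading.complete]
        rw [Fintype.sum_equiv (Equiv.mulLeft y⁻¹)
          (fun x => TensorProduct.map (X.proj y) (Y.proj (y⁻¹ * x)))
          (fun x => TensorProduct.map (X.proj y) (Y.proj x)) (fun _ => rfl)]
        simp only [← TensorProduct.mapBilinear_apply, map_sum]
      simp only [h1]
      have h2 : ∑ y, TensorProduct.map (X.proj y) (1 : Module.End k Y.V) =
          TensorProduct.map (∑ y, X.proj y) (1 : Module.End k Y.V) := by
        simp only [← TensorProduct.mapBilinear_apply, map_sum, LinearMap.sum_apply]
      rw [h2, X.isGrading.complete, TensorProduct.map_one]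

theorem Homog.tmul {X Y : Vec ω} {a b : G} {x : X.V} {y : Y.V} (hx : X.Homog a x)
    (hy : Y.Homog b y) : (tens X Y).Homog (a * b) (x ⊗ₜ[k] y) := by
  change (∑ y, TensorProduct.map (X.proj y) (Y.proj (y⁻¹ * (a * b)))) _ = _
  simp only [LinearMap.sum_apply, TensorProduct.map_tmul]
  rw [Finset.sum_eq_single a]
  · simp [hx.proj_eq, hy.proj_eq]
  · intro c _ hc
    simp [hx.proj_eq, hc]
  · simp

theorem ext2 {X Y : Vec ω} {M : Type u} [AddCommGroup M] [Module k M]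
    {f g : X.V ⊗[k] Y.V →ₗ[k] M}
    (h : ∀ a b x y, X.Homog a x → Y.Homog b y → f (x ⊗ₜ y) = g (x ⊗ₜ y)) : f = g := by
  apply TensorProduct.ext
  apply ext1
  intro a x hx
  apply ext1
  intro b y hy
  exact h a b x y hx hy

theorem ext3 {X Y Z : Vec ω} {M : Type u} [AddCommGroup M] [Module k M]
    {f g : (X.V ⊗[k] Y.V) ⊗[k] Z.V →ₗ[k] M}
    (h : ∀ a b c x y z, X.Homog a x → Y.Homog b y → Z.Homog c z →
      f ((x ⊗ₜ y) ⊗ₜ z) = g ((x ⊗ₜ y) ⊗ₜ z)) : f = g := by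
  apply TensorProduct.ext
  apply ext2
  intro a b x y hx hy
  apply ext1
  intro c z hz
  exact h a b c x y z hx hy hz

theorem ext3' {X Y Z : Vec ω} {M : Type u} [AddCommGroup M] [Module k M]
    {f g : X.V ⊗[k] (Y.V ⊗[k] Z.V) →ₗ[k] M}
    (h : ∀ a b c x y z, X.Homog a x → Y.Homog b y → Z.Homog c z →
      f (x ⊗ₜ (y ⊗ₜ z)) = g (x ⊗ₜ (y ⊗ₜ z))) : f = g := by
  apply TensorProduct.ext
  apply ext1
  intro a x hx
  apply ext2
  intro b c y z hy hz
  exact h a b c x y z hx hy hz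

theorem ext4 {X Y Z W : Vec ω} {M : Type u} [AddCommGroup M] [Module k M]
    {f g : ((X.V ⊗[k] Y.V) ⊗[k] Z.V) ⊗[k] W.V →ₗ[k] M}
    (h : ∀ a b c d x y z w, X.Homog a x → Y.Homog b y → Z.Homog c z → W.Homog d w →
      f (((x ⊗ₜ y) ⊗ₜ z) ⊗ₜ w) = g (((x ⊗ₜ y) ⊗ₜ z) ⊗ₜ w)) : f = g := by
  apply TensorProduct.ext
  apply ext3
  intro a b c x y z hx hy hz
  apply ext1
  intro d w hw
  exact h a b c d x y z w hx hy hz hw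

/-- The tensor product of two morphisms. -/
@[simps]
def tensMap {X Y X' Y' : Vec ω} (f : X ⟶ Y) (g : X' ⟶ Y') : tens X X' ⟶ tens Y Y' where
  hom := TensorProduct.map f.hom g.hom
  comm a := by
    apply ext2
    intro b c x y hx hy
    simp only [LinearMap.comp_apply, (hx.tmul hy).proj_eq, TensorProduct.map_tmul,
      ((hx.map f).tmul (hy.map g)).proj_eq]
    split_ifs <;> simp

/-- The map `(x ⊗ y) ⊗ z ↦ ω⁻¹(a, b, c) x ⊗ (y ⊗ z)` for `x, y, z` of degrees `a, b, c`. -/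
def assocHom (X Y Z : Vec ω) : (X.V ⊗[k] Y.V) ⊗[k] Z.V →ₗ[k] X.V ⊗[k] (Y.V ⊗[k] Z.V) :=
  (TensorProduct.assoc k X.V Y.V Z.V).toLinearMap ∘ₗ
    ∑ a, ∑ b, ∑ c, (((ω a b c)⁻¹ : kˣ) : k) •
      TensorProduct.map (TensorProduct.map (X.proj a) (Y.proj b)) (Z.proj c)

/-- The map `x ⊗ (y ⊗ z) ↦ ω(a, b, c) (x ⊗ y) ⊗ z` for `x, y, z` of degrees `a, b, c`. -/
def assocInv (X Y Z : Vec ω) : X.V ⊗[k] (Y.V ⊗[k] Z.V) →ₗ[k] (X.V ⊗[k] Y.V) ⊗[k] Z.V :=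
  (TensorProduct.assoc k X.V Y.V Z.V).symm.toLinearMap ∘ₗ
    ∑ a, ∑ b, ∑ c, ((ω a b c : kˣ) : k) •
      TensorProduct.map (X.proj a) (TensorProduct.map (Y.proj b) (Z.proj c))

theorem assocHom_apply {X Y Z : Vec ω} {a b c : G} {x : X.V} {y : Y.V} {z : Z.V}
    (hx : X.Homog a x) (hy : Y.Homog b y) (hz : Z.Homog c z) :
    assocHom X Y Z ((x ⊗ₜ y) ⊗ₜ z) = (((ω a b c)⁻¹ : kˣ) : k) • (x ⊗ₜ (y ⊗ₜ z)) := by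
  simp only [assocHom, LinearMap.comp_apply, LinearMap.sum_apply, LinearMap.smul_apply,
    TensorProduct.map_tmul, hx.proj_eq, hy.proj_eq, hz.proj_eq]
  rw [Finset.sum_eq_single a, Finset.sum_eq_single b, Finset.sum_eq_single c]
  · simp
  all_goals simp +contextual

theorem assocInv_apply {X Y Z : Vec ω} {a b c : G} {x : X.V} {y : Y.V} {z : Z.V}
    (hx : X.Homog a x) (hy : Y.Homog b y) (hz : Z.Homog c z) :
    assocInv X Y Z (x ⊗ₜ (y ⊗ₜ z)) = ((ω a b c : kˣ) : k) • ((x ⊗ₜ y) ⊗ₜ z) := by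
  simp only [assocInv, LinearMap.comp_apply, LinearMap.sum_apply, LinearMap.smul_apply,
    TensorProduct.map_tmul, hx.proj_eq, hy.proj_eq, hz.proj_eq]
  rw [Finset.sum_eq_single a, Finset.sum_eq_single b, Finset.sum_eq_single c]
  · simp
  all_goals simp +contextual

/-- The associativity constraint, `ω⁻¹(a, b, c)` on the component of degrees `a, b, c`. -/
@[simps]
def assoc (X Y Z : Vec ω) : tens (tens X Y) Z ≅ tens X (tens Y Z) where
  hom :=
    { hom := assocHom X Y Z
      comm := fun g => by
        apply ext3
        intro a b c x y z hx hy hz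
        simp only [LinearMap.comp_apply, ((hx.tmul hy).tmul hz).proj_eq,
          assocHom_apply hx hy hz, map_smul, (hx.tmul (hy.tmul hz)).proj_eq, mul_assoc]
        split_ifs
        · rw [assocHom_apply hx hy hz]
        · simp }
  inv :=
    { hom := assocInv X Y Z
      comm := fun g => by
        apply ext3'
        intro a b c x y z hx hy hz
        simp only [LinearMap.comp_apply, ((hx.tmul hy).tmul hz).proj_eq,
          assocInv_apply hx hy hz, map_smul, (hx.tmul (hy.tmul hz)).proj_eq, mul_assoc]
        split_ifs
        · rw [assocInv_apply hx hy hz]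
        · simp }
  hom_inv_id := by
    apply hom_ext
    apply ext3
    intro a b c x y z hx hy hz
    simp only [comp_hom, LinearMap.comp_apply, assocHom_apply hx hy hz, map_smul,
      assocInv_apply hx hy hz, smul_smul]
    simp
  inv_hom_id := by
    apply hom_ext
    apply ext3'
    intro a b c x y z hx hy hz
    simp only [comp_hom, LinearMap.comp_apply, assocHom_apply hx hy hz, map_smul,
      assocInv_apply hx hy hz, smul_smul]
    simp

theorem homog_δ (ω : Cocycle3 k G) (g : G) (c : k) : (δ ω g).Homog g c := by
  simp only [Homog, if_true]; rfl

theorem homog_δ_eq {ω : Cocycle3 k G} {a g : G} {c : k} (h : (δ ω g).Homog a c) :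
    a = g ∨ c = 0 := by
  by_cases hag : a = g
  · exact Or.inl hag
  · right
    have : (δ ω g).proj a c = c := h
    rw [← this]; simp only [if_neg hag]; rfl

/-- The left unit constraint `c ⊗ x ↦ c x`. -/
@[simps]
def leftUnitor (X : Vec ω) : tens (δ ω 1) X ≅ X where
  hom :=
    { hom := (TensorProduct.lid k X.V).toLinearMap
      comm := comm_of_homog (X := tens (δ ω 1) X) _ fun a x hx => by
        have key : ((TensorProduct.lid k X.V).toLinearMap ∘ₗ (tens (δ ω 1) X).proj a) =
            X.proj a ∘ₗ (TensorProduct.lid k X.V).toLinearMap := by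
          apply ext2 (X := δ ω 1)
          intro b c r y hr hy
          rcases homog_δ_eq hr with rfl | rfl
          · simp only [LinearMap.comp_apply, (hr.tmul hy).proj_eq, one_mul]
            split_ifs with h <;> simp [hy.proj_eq, h]
          · simp
        have := LinearMap.congr_fun key x
        simp only [LinearMap.comp_apply] at this
        rw [Homog, ← this, hx] }
  inv :=
    { hom := (TensorProduct.lid k X.V).symm.toLinearMap
      comm := comm_of_homog (Y := tens (δ ω 1) X) _ fun a x hx => by
        simpa using (homog_δ ω 1 (1 : k)).tmul hx }
  hom_inv_id := by
    apply hom_ext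
    apply LinearMap.ext
    intro x
    exact (TensorProduct.lid k X.V).symm_apply_apply x
  inv_hom_id := by
    apply hom_ext
    apply LinearMap.ext
    intro x
    exact (TensorProduct.lid k X.V).apply_symm_apply x

/-- The right unit constraint `x ⊗ c ↦ c x`. -/
@[simps]
def rightUnitor (X : Vec ω) : tens X (δ ω 1) ≅ X where
  hom :=
    { hom := (TensorProduct.rid k X.V).toLinearMap
      comm := comm_of_homog (X := tens X (δ ω 1)) _ fun a x hx => by
        have key : ((TensorProduct.rid k X.V).toLinearMap ∘ₗ (tens X (δ ω 1)).proj a) =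
            X.proj a ∘ₗ (TensorProduct.rid k X.V).toLinearMap := by
          apply ext2 (Y := δ ω 1)
          intro b c y r hy hr
          rcases homog_δ_eq hr with rfl | rfl
          · simp only [LinearMap.comp_apply, (hy.tmul hr).proj_eq, mul_one]
            split_ifs with h <;> simp [hy.proj_eq, h]
          · simp
        have := LinearMap.congr_fun key x
        simp only [LinearMap.comp_apply] at this
        rw [Homog, ← this, hx] }
  inv :=
    { hom := (TensorProduct.rid k X.V).symm.toLinearMap
      comm := comm_of_homog (Y := tens X (δ ω 1)) _ fun a x hx => by
        simpa using hx.tmul (homog_δ ω 1 (1 : k)) }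
  hom_inv_id := by
    apply hom_ext
    apply LinearMap.ext
    intro x
    exact (TensorProduct.rid k X.V).symm_apply_apply x
  inv_hom_id := by
    apply hom_ext
    apply LinearMap.ext
    intro x
    exact (TensorProduct.rid k X.V).apply_symm_apply x


instance : MonoidalCategory (Vec ω) where
  tensorObj := tens
  whiskerLeft X _ _ f := tensMap (𝟙 X) f
  whiskerRight f Y := tensMap f (𝟙 Y)
  tensorHom := tensMap
  tensorUnit := δ ω 1
  associator := assoc
  leftUnitor := leftUnitor
  rightUnitor := rightUnitor
  tensorHom_def f g := by
    apply hom_ext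
    apply ext2
    intros
    rfl
  id_tensorHom_id X Y := by
    apply hom_ext
    apply ext2
    intros
    rfl
  tensorHom_comp_tensorHom f g f' g' := by
    apply hom_ext
    apply ext2
    intros
    rfl
  whiskerLeft_id X Y := by
    apply hom_ext
    apply ext2
    intros
    rfl
  id_whiskerRight X Y := by
    apply hom_ext
    apply ext2
    intros
    rfl
  associator_naturality f g h := by
    apply hom_ext
    apply ext3
    intro a b c x y z hx hy hz
    simp only [comp_hom, LinearMap.comp_apply, assoc_hom_hom, assocHom_apply hx hy hz,
      tensMap_hom, TensorProduct.map_tmul, map_smul,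
      assocHom_apply (hx.map f) (hy.map g) (hz.map h)]
  leftUnitor_naturality f := by
    apply hom_ext
    apply ext2 (X := δ ω 1)
    intro a b r x _ _
    simp
  rightUnitor_naturality f := by
    apply hom_ext
    apply ext2 (Y := δ ω 1)
    intro a b x r _ _
    simp
  pentagon W X Y Z := by
    apply hom_ext
    apply ext4
    intro a b c d w x y z hw hx hy hz
    simp only [comp_hom, LinearMap.comp_apply, assoc_hom_hom, tensMap_hom,
      TensorProduct.map_tmul, id_hom, LinearMap.id_apply, map_smul,
      assocHom_apply hw hx hy, assocHom_apply hx hy hz, assocHom_apply (hw.tmul hx) hy hz,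
      assocHom_apply hw hx (hy.tmul hz), assocHom_apply hw (hx.tmul hy) hz,
      TensorProduct.tmul_smul, ← TensorProduct.smul_tmul', smul_smul, ← Units.val_mul,
      ← mul_inv]
    rw [ω.cocycle a b c d, mul_assoc]
  triangle X Y := by
    apply hom_ext
    apply ext3 (Y := δ ω 1)
    intro a b c x r y hx hr hy
    rcases homog_δ_eq hr with rfl | rfl
    · simp only [comp_hom, LinearMap.comp_apply, assoc_hom_hom, tensMap_hom,
        assocHom_apply hx hr hy, ω.normalized, inv_one, Units.val_one, one_smul,
        TensorProduct.map_tmul, id_hom, LinearMap.id_apply, leftUnitor_hom_hom,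
        rightUnitor_hom_hom, LinearEquiv.coe_coe, TensorProduct.lid_tmul, TensorProduct.rid_tmul,
        TensorProduct.smul_tmul]
    · simp

theorem whiskerLeft_hom (X : Vec ω) {Y Z : Vec ω} (f : Y ⟶ Z) :
    (X ◁ f).hom = TensorProduct.map LinearMap.id f.hom := rfl

theorem whiskerRight_hom {Y Z : Vec ω} (f : Y ⟶ Z) (X : Vec ω) :
    (f ▷ X).hom = TensorProduct.map f.hom LinearMap.id := rfl

theorem associator_hom_hom (X Y Z : Vec ω) : (α_ X Y Z).hom.hom = assocHom X Y Z := rfl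

/-- The graded vector space of linear maps `X → Z`, where `φ` has degree `g` when
it maps degree `a` to degree `s a g`, for a fixed family of bijections `s a`. -/
abbrev linHom (X Z : Vec ω) (s : G → G ≃ G) : Vec ω where
  V := X.V →ₗ[k] Z.V
  proj g :=
    { toFun := fun φ => ∑ a, Z.proj (s a g) ∘ₗ φ ∘ₗ X.proj a
      map_add' := fun φ ψ => by
        simp only [LinearMap.add_comp, LinearMap.comp_add, Finset.sum_add_distrib]
      map_smul' := fun c φ => by
        simp only [LinearMap.smul_comp, LinearMap.comp_smul, Finset.smul_sum, RingHom.id_apply] }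
  isGrading := by
    rw [CompleteOrthogonalIdempotents.iff_ortho_complete]
    refine ⟨fun g h hgh => ?_, ?_⟩
    · apply LinearMap.ext
      intro φ
      apply ext1
      intro a x hx
      simp only [Module.End.mul_apply, LinearMap.coe_mk, AddHom.coe_mk, LinearMap.sum_apply,
        LinearMap.comp_apply, LinearMap.zero_apply]
      refine Finset.sum_eq_zero fun b _ => ?_
      rw [map_sum]
      refine Finset.sum_eq_zero fun c _ => ?_
      simp only [hx.proj_eq, proj_proj]
      by_cases hb : b = a
      · subst hb
        simp only [if_true, hx.proj_eq]
        by_cases hc : c = b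
        · subst hc
          rw [if_neg (fun h' => hgh ((s c).injective h'))]
        · simp [hc]
      · simp [hb]
    · apply LinearMap.ext
      intro φ
      apply ext1
      intro a x hx
      simp only [LinearMap.sum_apply, LinearMap.coe_mk, AddHom.coe_mk,
        LinearMap.comp_apply, Module.End.one_apply]
      have : ∀ g : G, ∑ b, Z.proj (s b g) (φ (X.proj b x)) = Z.proj (s a g) (φ x) := by
        intro g
        rw [Finset.sum_eq_single a]
        · rw [hx]
        · intro b _ hb
          simp [hx.proj_eq, hb]
        · simp
      simp only [this]
      rw [Fintype.sum_equiv (s a) (fun g => Z.proj (s a g) (φ x)) (fun g => Z.proj g (φ x))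
        (fun _ => rfl), sum_proj]

theorem homog_linHom {X Z : Vec ω} {s : G → G ≃ G} {g : G} {φ : X.V →ₗ[k] Z.V}
    (h : (linHom X Z s).Homog g φ) {a : G} {x : X.V} (hx : X.Homog a x) :
    Z.Homog (s a g) (φ x) := by
  have h1 : ∑ b, Z.proj (s b g) (φ (X.proj b x)) = φ x := by
    have := LinearMap.congr_fun (show (∑ b, Z.proj (s b g) ∘ₗ φ ∘ₗ X.proj b) = φ from h) x
    simpa only [LinearMap.sum_apply, LinearMap.comp_apply] using this
  rw [Finset.sum_eq_single a, hx] at h1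
  · exact h1
  · intro b _ hb
    simp [hx.proj_eq, hb]
  · simp

theorem homog_linHom_of {X Z : Vec ω} {s : G → G ≃ G} {g : G} {φ : X.V →ₗ[k] Z.V}
    (h : ∀ a x, X.Homog a x → Z.Homog (s a g) (φ x)) : (linHom X Z s).Homog g φ := by
  change (∑ b, Z.proj (s b g) ∘ₗ φ ∘ₗ X.proj b) = φ
  apply ext1
  intro a x hx
  simp only [LinearMap.sum_apply, LinearMap.comp_apply]
  rw [Finset.sum_eq_single a, hx]
  · exact h a x hx
  · intro b _ hb
    simp [hx.proj_eq, hb]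
  · simp

/-- Postcomposition, as a functor from `Z` to the graded space of linear maps `X → Z`. -/
def linHomFunctor (X : Vec ω) (s : G → G ≃ G) : Vec ω ⥤ Vec ω where
  obj Z := linHom X Z s
  map {Z Z'} f :=
    { hom := LinearMap.llcomp k X.V Z.V Z'.V f.hom
      comm := comm_of_homog (X := linHom X Z s) (Y := linHom X Z' s) _ fun _ _ hφ =>
        homog_linHom_of fun _ _ hx => (homog_linHom hφ hx).map f }
  map_id _ := rfl
  map_comp _ _ := rfl

/-- Currying: tensoring on the left with `X` has a right adjoint. -/
def tensorLeftAdj (X : Vec ω) : tensorLeft X ⊣ linHomFunctor X (fun a => Equiv.mulLeft a) :=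
  Adjunction.mkOfHomEquiv
    { homEquiv := fun Y Z =>
        { toFun := fun f =>
            { hom := (TensorProduct.curry f.hom).flip
              comm := comm_of_homog (Y := linHom X Z _) _ fun b y hy =>
                homog_linHom_of fun a x hx => (hx.tmul hy).map f }
          invFun := fun f =>
            { hom := TensorProduct.lift (LinearMap.flip f.hom)
              comm := fun g => by
                apply ext2
                intro a b x y hx hy
                have h1 : Z.Homog (a * b) ((show X.V →ₗ[k] Z.V from f.hom y) x) := homog_linHom (hy.map f) hx
                simp only [LinearMap.comp_apply]
                change _ = Z.proj g ((show X.V →ₗ[k] Z.V from f.hom y) x)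
                erw [(hx.tmul hy).proj_eq, h1.proj_eq]
                split_ifs
                · rfl
                · exact map_zero _ }
          left_inv := fun f => by
            apply hom_ext
            apply ext2
            intros
            rfl
          right_inv := fun f => rfl }
      homEquiv_naturality_left_symm := fun f g => by
        apply hom_ext
        apply ext2
        intros
        rfl
      homEquiv_naturality_right := fun f g => rfl }

/-- Currying: tensoring on the right with `X` has a right adjoint. -/
def tensorRightAdj (X : Vec ω) : tensorRight X ⊣ linHomFunctor X (fun a => Equiv.mulRight a) :=
  Adjunction.mkOfHomEquiv
    { homEquiv := fun Y Z =>
        { toFun := fun f =>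
            { hom := TensorProduct.curry f.hom
              comm := comm_of_homog (Y := linHom X Z _) _ fun b y hy =>
                homog_linHom_of fun a x hx => (hy.tmul hx).map f }
          invFun := fun f =>
            { hom := TensorProduct.lift f.hom
              comm := fun g => by
                apply ext2
                intro b a y x hy hx
                have h1 : Z.Homog (b * a) ((show X.V →ₗ[k] Z.V from f.hom y) x) := homog_linHom (hy.map f) hx
                simp only [LinearMap.comp_apply]
                change _ = Z.proj g ((show X.V →ₗ[k] Z.V from f.hom y) x)
                erw [(hy.tmul hx).proj_eq, h1.proj_eq]
                split_ifs
                · rfl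
                · exact map_zero _ }
          left_inv := fun f => by
            apply hom_ext
            apply ext2
            intros
            rfl
          right_inv := fun f => rfl }
      homEquiv_naturality_left_symm := fun f g => by
        apply hom_ext
        apply ext2
        intros
        rfl
      homEquiv_naturality_right := fun f g => rfl }

instance (X : Vec ω) : PreservesColimitsOfSize.{0, 0} (tensorLeft X) :=
  (tensorLeftAdj X).leftAdjoint_preservesColimits

instance (X : Vec ω) : PreservesColimitsOfSize.{0, 0} (tensorRight X) :=
  (tensorRightAdj X).leftAdjoint_preservesColimits

/-- The quotient of `Y` by the image of `f - g`. -/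
abbrev coeq {X Y : Vec ω} (f g : X ⟶ Y) : Vec ω where
  V := Y.V ⧸ LinearMap.range (f.hom - g.hom)
  proj a := Submodule.mapQ _ _ (Y.proj a) (by
    rintro _ ⟨x, rfl⟩
    refine ⟨X.proj a x, ?_⟩
    have h1 := LinearMap.congr_fun (f.comm a) x
    have h2 := LinearMap.congr_fun (g.comm a) x
    simp only [LinearMap.comp_apply] at h1 h2
    simp [h1, h2])
  isGrading := by
    rw [CompleteOrthogonalIdempotents.iff_ortho_complete]
    refine ⟨fun a b hab => ?_, ?_⟩
    · apply Submodule.linearMap_qext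
      ext y
      simp [proj_proj, hab]
    · apply Submodule.linearMap_qext
      ext y
      simp only [LinearMap.comp_apply, LinearMap.sum_apply, Submodule.mkQ_apply,
        Submodule.mapQ_apply, Module.End.one_apply]
      simp only [← Submodule.mkQ_apply, ← map_sum, sum_proj]

/-- The projection onto the cokernel of `f - g`. -/
def coeqπ {X Y : Vec ω} (f g : X ⟶ Y) : Y ⟶ coeq f g where
  hom := Submodule.mkQ _
  comm _ := rfl

theorem coeqπ_condition {X Y : Vec ω} (f g : X ⟶ Y) : f ≫ coeqπ f g = g ≫ coeqπ f g := by
  apply hom_ext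
  apply LinearMap.ext
  intro x
  exact (Submodule.Quotient.eq _).2 ⟨x, rfl⟩

instance : HasCoequalizers (Vec ω) := by
  refine @hasCoequalizers_of_hasColimit_parallelPair _ _ ?_
  intro X Y f g
  refine ⟨⟨⟨Cofork.ofπ (coeqπ f g) (coeqπ_condition f g), ?_⟩⟩⟩
  refine Cofork.IsColimit.mk _ (fun s => ?_) (fun s => ?_) (fun s m hm => ?_)
  · refine ⟨Submodule.liftQ _ s.π.hom ?_, fun a => ?_⟩
    · rintro _ ⟨x, rfl⟩
      have := congrArg (fun t : X ⟶ _ => t.hom x) s.condition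
      simp only [comp_hom, LinearMap.comp_apply] at this
      simp [this]
    · apply Submodule.linearMap_qext
      exact s.π.comm a
  · rfl
  · apply hom_ext
    apply Submodule.linearMap_qext
    have := congrArg Hom.hom hm
    exact this

/-- The inclusion of the summand indexed by `s` into the direct sum of the `δ (d s)`. -/
@[simps]
def ofDegreesι {S : Type u} [Finite S] (d : S → G) (s : S) : δ ω (d s) ⟶ ofDegrees ω d where
  hom := Finsupp.lsingle s
  comm g := by
    ext
    by_cases h : d s = g
    · simp [h]
    · simp [h, Ne.symm h]

theorem homog_single {S : Type u} [Finite S] (d : S → G) (s : S) (c : k) :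
    (ofDegrees ω d).Homog (d s) (Finsupp.single s c) := by
  simp [Homog]

theorem Homog.smul {X : Vec ω} {a : G} {x : X.V} (h : X.Homog a x) (c : k) :
    X.Homog a (c • x) := by
  rw [Homog, map_smul, h]

theorem Homog.sum {X : Vec ω} {a : G} {T : Type u} (s : Finset T) (x : T → X.V)
    (h : ∀ i ∈ s, X.Homog a (x i)) : X.Homog a (∑ i ∈ s, x i) := by
  rw [Homog, map_sum]
  exact Finset.sum_congr rfl h

theorem comm_ofDegrees {S : Type u} [Finite S] {d : S → G} {Y : Vec ω}
    (f : (S →₀ k) →ₗ[k] Y.V) (h : ∀ s, Y.Homog (d s) (f (Finsupp.single s 1))) (g : G) :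
    f ∘ₗ (ofDegrees ω d).proj g = Y.proj g ∘ₗ f := by
  ext s
  simp only [LinearMap.comp_apply, Finsupp.lsingle_apply, (homog_single d s 1).proj_eq,
    (h s).proj_eq]
  split_ifs <;> simp

theorem ext_single₂ {S T : Type u} {M : Type u} [AddCommGroup M] [Module k M]
    {f g : (S →₀ k) ⊗[k] (T →₀ k) →ₗ[k] M}
    (h : ∀ s t, f (Finsupp.single s 1 ⊗ₜ Finsupp.single t 1) =
      g (Finsupp.single s 1 ⊗ₜ Finsupp.single t 1)) : f = g := by
  apply TensorProduct.ext
  ext s t : 4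
  exact h s t

theorem ext_single₃ {S T U : Type u} {M : Type u} [AddCommGroup M] [Module k M]
    {f g : ((S →₀ k) ⊗[k] (T →₀ k)) ⊗[k] (U →₀ k) →ₗ[k] M}
    (h : ∀ s t u, f ((Finsupp.single s 1 ⊗ₜ Finsupp.single t 1) ⊗ₜ Finsupp.single u 1) =
      g ((Finsupp.single s 1 ⊗ₜ Finsupp.single t 1) ⊗ₜ Finsupp.single u 1)) : f = g := by
  apply TensorProduct.ext
  apply ext_single₂
  intro s t
  ext u : 2
  exact h s t u

theorem comm_ofDegrees₂ {S T : Type u} [Finite S] [Finite T] {d : S → G} {d' : T → G} {Y : Vec ω}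
    (f : (S →₀ k) ⊗[k] (T →₀ k) →ₗ[k] Y.V)
    (h : ∀ s t, Y.Homog (d s * d' t) (f (Finsupp.single s 1 ⊗ₜ Finsupp.single t 1))) (g : G) :
    f ∘ₗ (tens (ofDegrees ω d) (ofDegrees ω d')).proj g = Y.proj g ∘ₗ f := by
  apply ext_single₂
  intro s t
  have h1 := (homog_single (ω := ω) d s 1).tmul (homog_single (ω := ω) d' t 1)
  rw [LinearMap.comp_apply, LinearMap.comp_apply, h1.proj_eq, (h s t).proj_eq]
  split_ifs <;> simp

end Vec

open Vec

/-! ### Twisted group algebras -/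

section TwistedGroupAlgebra

variable {ω : Cocycle3 k G} {L : Subgroup G}

/-- The object `⨁_{g ∈ L} δ_g`. -/
abbrev groupObj (ω : Cocycle3 k G) (L : Subgroup G) : Vec ω :=
  ofDegrees ω (fun g : L => (g : G))

/-- `δ_g ⊗ δ_g' ↦ ψ(g, g') δ_{g g'}`. -/
def twistedMul (ψ : Cochain2 ω L) : groupObj ω L ⊗ groupObj ω L ⟶ groupObj ω L where
  hom := TensorProduct.lift (Finsupp.linearCombination k fun g =>
    Finsupp.linearCombination k fun g' => Finsupp.single (g * g') (ψ g g' : k))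
  comm := comm_ofDegrees₂ _ fun g g' => by
    simpa using homog_single (ω := ω) (fun g : L => (g : G)) (g * g') (ψ g g' : k)

theorem twistedMul_single (ψ : Cochain2 ω L) (g g' : L) :
    (twistedMul ψ).hom (Finsupp.single g (1 : k) ⊗ₜ[k] Finsupp.single g' (1 : k)) =
      (ψ g g' : k) • Finsupp.single (g * g') (1 : k) := by
  change Finsupp.linearCombination k (fun g => Finsupp.linearCombination k fun g' =>
    Finsupp.single (g * g') (ψ g g' : k)) (Finsupp.single g 1) (Finsupp.single g' 1) = _
  simp

/-- `δ_e ↦ δ_e`. -/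
def twistedOne (ω : Cocycle3 k G) (L : Subgroup G) : 𝟙_ (Vec ω) ⟶ groupObj ω L :=
  ofDegreesι (ω := ω) (fun g : L => (g : G)) 1

/-- `δ_g ↦ |L|⁻¹ ∑_{h ∈ L} ψ⁻¹(g h, h⁻¹) δ_{g h} ⊗ δ_{h⁻¹}`. -/
def twistedComul [Fintype L] (ψ : Cochain2 ω L) :
    groupObj ω L ⟶ groupObj ω L ⊗ groupObj ω L where
  hom := Finsupp.linearCombination k fun g => (Fintype.card L : k)⁻¹ •
    ∑ h : L, (((ψ (g * h) h⁻¹)⁻¹ : kˣ) : k) •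
      (Finsupp.single (g * h) (1 : k) ⊗ₜ[k] Finsupp.single h⁻¹ (1 : k))
  comm := comm_ofDegrees (Y := groupObj ω L ⊗ groupObj ω L) _ fun g => by
    rw [Finsupp.linearCombination_single, one_smul]
    refine Homog.smul (Homog.sum _ _ fun h _ => Homog.smul ?_ _) _
    have := (homog_single (ω := ω) (fun g : L => (g : G)) (g * h) 1).tmul
      (homog_single (ω := ω) (fun g : L => (g : G)) h⁻¹ 1)
    have h2 : ((g * h : L) : G) * ((h⁻¹ : L) : G) = g := by simp
    rwa [h2] at this

/-- `δ_g ↦ |L| δ_e` if `g = e`, and `δ_g ↦ 0` otherwise. -/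
def twistedCounit (ω : Cocycle3 k G) (L : Subgroup G) [Fintype L] :
    groupObj ω L ⟶ 𝟙_ (Vec ω) where
  hom := Finsupp.linearCombination k fun g => if g = 1 then (Fintype.card L : k) else 0
  comm := comm_ofDegrees (Y := δ ω 1) _ fun g => by
    rw [Finsupp.linearCombination_single, one_smul]
    split_ifs with h
    · subst h
      exact homog_δ ω 1 _
    · simp [Homog]

/-- The twisted group algebra `A(L, ψ)`. -/
@[simps X]
def twistedGroupAlgebra (ψ : Cochain2 ω L) : Mon (Vec ω) where
  X := groupObj ω L
  mon :=
    { mul := twistedMul ψ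
      one := twistedOne ω L
      one_mul := by
        apply hom_ext
        apply TensorProduct.ext
        ext g : 3
        refine (twistedMul_single ψ 1 g).trans ?_
        rw [ψ.one_left, one_mul]
        exact (TensorProduct.lid_tmul _ _).symm
      mul_one := by
        apply hom_ext
        apply TensorProduct.ext
        ext g : 3
        refine (twistedMul_single ψ g 1).trans ?_
        rw [ψ.one_right, mul_one]
        exact (TensorProduct.rid_tmul _ _).symm
      mul_assoc := by
        apply hom_ext
        apply ext_single₃
        intro a b c
        have h1 := assocHom_apply (homog_single (ω := ω) (fun g : L => (g : G)) a 1)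
          (homog_single (ω := ω) (fun g : L => (g : G)) b 1)
          (homog_single (ω := ω) (fun g : L => (g : G)) c 1)
        trans ((ψ a b : k) * ψ (a * b) c) • Finsupp.single (a * b * c) (1 : k)
        · change (twistedMul ψ).hom ((twistedMul ψ).hom _ ⊗ₜ[k] Finsupp.single c (1 : k)) = _
          rw [twistedMul_single, ← TensorProduct.smul_tmul', map_smul, twistedMul_single,
            smul_smul]
        · change _ = (twistedMul ψ).hom ((TensorProduct.map LinearMap.id (twistedMul ψ).hom)
            (assocHom _ _ _ _))
          rw [h1, map_smul, map_smul, TensorProduct.map_tmul, twistedMul_single,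
            TensorProduct.tmul_smul, map_smul, LinearMap.id_apply, twistedMul_single,
            smul_smul, smul_smul, mul_assoc a b c]
          congr 1
          rw [← Units.val_mul, ← Units.val_mul, ← Units.val_mul, mul_assoc,
            mul_comm (ψ b c), ψ.coboundary a b c, mul_assoc, inv_mul_cancel_left, mul_comm] }

end TwistedGroupAlgebra
end Vec

/-! ### Frobenius algebras, bimodules and the free bimodule functor -/

section General

variable {C : Type*} [Category C] [MonoidalCategory C]

/-- A Frobenius algebra structure on an object of a monoidal category. -/
class FrobeniusObj (X : C) extends MonObj X, ComonObj X where
  frobenius_left : X ◁ comul ≫ (α_ X X X).inv ≫ mul ▷ X = mul ≫ comul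
  frobenius_right : comul ▷ X ≫ (α_ X X X).hom ≫ X ◁ mul = mul ≫ comul

section BimodMonoidal

variable [HasCoequalizers C] [∀ X : C, PreservesColimitsOfSize.{0, 0} (tensorLeft X)]
  [∀ X : C, PreservesColimitsOfSize.{0, 0} (tensorRight X)]

/-- The monoidal category of `A`-bimodules, with tensor product `⊗_A` and unit `A`. -/
instance (A : Mon C) : MonoidalCategory (Bimod A A) where
  tensorObj M N := M.tensorBimod N
  whiskerLeft M _ _ f := Bimod.whiskerLeft M f
  whiskerRight f N := Bimod.whiskerRight f N
  tensorUnit := Bimod.regular A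
  associator := Bimod.associatorBimod
  leftUnitor := Bimod.leftUnitorBimod
  rightUnitor := Bimod.rightUnitorBimod
  tensorHom_comp_tensorHom f g f' g' :=
    letI := Bimod.monBicategory (C := C)
    MonoidalCategory.tensorHom_comp_tensorHom (C := EndMonoidal A) f g f' g'
  id_tensorHom_id M N :=
    letI := Bimod.monBicategory (C := C)
    MonoidalCategory.id_tensorHom_id (C := EndMonoidal A) M N
  whiskerLeft_id _ _ := Bimod.whiskerLeft_id_bimod
  id_whiskerRight _ _ := Bimod.id_whiskerRight_bimod
  associator_naturality f g h :=
    letI := Bimod.monBicategory (C := C)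
    MonoidalCategory.associator_naturality (C := EndMonoidal A) f g h
  leftUnitor_naturality f :=
    letI := Bimod.monBicategory (C := C)
    MonoidalCategory.leftUnitor_naturality (C := EndMonoidal A) f
  rightUnitor_naturality f :=
    letI := Bimod.monBicategory (C := C)
    MonoidalCategory.rightUnitor_naturality (C := EndMonoidal A) f
  pentagon := Bimod.pentagon_bimod
  triangle := Bimod.triangle_bimod

/-- The canonical projection `M ⊗ N ⟶ M ⊗_A N`. -/
def tensorπ {A : Mon C} (M N : Bimod A A) : M.X ⊗ N.X ⟶ (M ⊗ N : Bimod A A).X :=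
  coequalizer.π (M.actRight ▷ N.X) ((α_ _ _ _).hom ≫ (M.X ◁ N.actLeft))

end BimodMonoidal

/-- The free `A`-bimodule `(A ⊗ X) ⊗ A`. -/
abbrev freeBimod (A : Mon C) (X : C) : Bimod A A where
  X := (A.X ⊗ X) ⊗ A.X
  actLeft := (α_ A.X (A.X ⊗ X) A.X).inv ≫ ((α_ A.X A.X X).inv ≫ MonObj.mul ▷ X) ▷ A.X
  actRight := (α_ (A.X ⊗ X) A.X A.X).hom ≫ (A.X ⊗ X) ◁ MonObj.mul
  one_actLeft := by
    have h : MonObj.one ▷ ((A.X ⊗ X) ⊗ A.X) ≫ (α_ A.X (A.X ⊗ X) A.X).inv ≫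
        ((α_ A.X A.X X).inv ≫ MonObj.mul ▷ X) ▷ A.X =
      𝟙 _ ⊗≫ ((MonObj.one ▷ A.X ≫ MonObj.mul) ▷ X) ▷ A.X ⊗≫ 𝟙 _ := by monoidal
    rw [h, MonObj.one_mul]
    monoidal
  left_assoc := by
    have h1 : MonObj.mul ▷ ((A.X ⊗ X) ⊗ A.X) ≫ (α_ A.X (A.X ⊗ X) A.X).inv ≫
        ((α_ A.X A.X X).inv ≫ MonObj.mul ▷ X) ▷ A.X =
      𝟙 _ ⊗≫ ((MonObj.mul ▷ A.X ≫ MonObj.mul) ▷ X) ▷ A.X ⊗≫ 𝟙 _ := by monoidal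
    rw [h1, MonObj.mul_assoc]
    monoidal
  actRight_one := by
    have h : ((A.X ⊗ X) ⊗ A.X) ◁ MonObj.one ≫ (α_ (A.X ⊗ X) A.X A.X).hom ≫
        (A.X ⊗ X) ◁ MonObj.mul =
      𝟙 _ ⊗≫ (A.X ⊗ X) ◁ (A.X ◁ MonObj.one ≫ MonObj.mul) ⊗≫ 𝟙 _ := by monoidal
    rw [h, MonObj.mul_one]
    monoidal
  right_assoc := by
    have h : ((A.X ⊗ X) ⊗ A.X) ◁ MonObj.mul ≫ (α_ (A.X ⊗ X) A.X A.X).hom ≫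
        (A.X ⊗ X) ◁ MonObj.mul =
      𝟙 _ ⊗≫ (A.X ⊗ X) ◁ ((α_ A.X A.X A.X).inv ≫ (α_ A.X A.X A.X).hom ≫
        A.X ◁ MonObj.mul ≫ MonObj.mul) ⊗≫ 𝟙 _ := by monoidal
    rw [h, ← MonObj.mul_assoc]
    monoidal
  middle_assoc := by
    have h : ((α_ A.X (A.X ⊗ X) A.X).inv ≫ ((α_ A.X A.X X).inv ≫ MonObj.mul ▷ X) ▷ A.X) ▷ A.X ≫
        (α_ (A.X ⊗ X) A.X A.X).hom ≫ (A.X ⊗ X) ◁ MonObj.mul =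
      𝟙 _ ⊗≫ (MonObj.mul ▷ (X ⊗ (A.X ⊗ A.X)) ≫ A.X ◁ (X ◁ MonObj.mul)) ⊗≫ 𝟙 _ := by monoidal
    rw [h, ← whisker_exchange]
    monoidal

/-- The free functor `X ↦ (A ⊗ X) ⊗ A` from `C` to `A`-bimodules in `C`. -/
abbrev freeFunctor (A : Mon C) : C ⥤ Bimod A A where
  obj := freeBimod A
  map {X Y} φ :=
    { hom := (A.X ◁ φ) ▷ A.X
      left_act_hom := by
        have h : ((α_ A.X (A.X ⊗ X) A.X).inv ≫ ((α_ A.X A.X X).inv ≫ MonObj.mul ▷ X) ▷ A.X) ≫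
            (A.X ◁ φ) ▷ A.X =
          𝟙 _ ⊗≫ (MonObj.mul ▷ X ≫ A.X ◁ φ) ▷ A.X ⊗≫ 𝟙 _ := by monoidal
        dsimp only [freeBimod]
        rw [h, ← whisker_exchange]
        monoidal
      right_act_hom := by
        dsimp only [freeBimod]
        rw [Category.assoc, whisker_exchange]
        monoidal }
  map_id X := by
    apply Bimod.hom_ext
    change (A.X ◁ 𝟙 X) ▷ A.X = 𝟙 ((A.X ⊗ X) ⊗ A.X)
    simp
  map_comp f g := by
    apply Bimod.hom_ext
    change (A.X ◁ (f ≫ g)) ▷ A.X = (A.X ◁ f) ▷ A.X ≫ (A.X ◁ g) ▷ A.X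
    simp

variable (A : Mon C)

/-- For a morphism `ε : A ⟶ 𝟙_ C`, the map `Φ(X) ⊗ Φ(Y) ⟶ Φ(X ⊗ Y)` that contracts the two inner
copies of `A` with `ε ∘ m_A`, where `Φ` is the free functor. -/
def freeLaxLift (ε : A.X ⟶ 𝟙_ C) (X Y : C) :
    (freeBimod A X).X ⊗ (freeBimod A Y).X ⟶ (freeBimod A (X ⊗ Y)).X :=
  (α_ ((A.X ⊗ X) ⊗ A.X) (A.X ⊗ Y) A.X).inv ≫
  (α_ (A.X ⊗ X) A.X (A.X ⊗ Y)).hom ▷ A.X ≫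
  ((A.X ⊗ X) ◁ (α_ A.X A.X Y).inv) ▷ A.X ≫
  ((A.X ⊗ X) ◁ ((MonObj.mul ≫ ε) ▷ Y)) ▷ A.X ≫
  ((A.X ⊗ X) ◁ (λ_ Y).hom) ▷ A.X ≫
  (α_ A.X X Y).hom ▷ A.X

/-- For a morphism `d : A ⟶ A ⊗ A`, the map `Φ(X ⊗ Y) ⟶ Φ(X) ⊗ Φ(Y)` that inserts `d ∘ u_A`
in the middle, where `Φ` is the free functor. -/
def freeOplaxLift (d : A.X ⟶ A.X ⊗ A.X) (X Y : C) :
    (freeBimod A (X ⊗ Y)).X ⟶ (freeBimod A X).X ⊗ (freeBimod A Y).X :=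
  (α_ A.X X Y).inv ▷ A.X ≫
  ((A.X ⊗ X) ◁ (λ_ Y).inv) ▷ A.X ≫
  ((A.X ⊗ X) ◁ ((MonObj.one ≫ d) ▷ Y)) ▷ A.X ≫
  ((A.X ⊗ X) ◁ (α_ A.X A.X Y).hom) ▷ A.X ≫
  (α_ (A.X ⊗ X) A.X (A.X ⊗ Y)).inv ▷ A.X ≫
  (α_ ((A.X ⊗ X) ⊗ A.X) (A.X ⊗ Y) A.X).hom

/-- For a morphism `d : A ⟶ A ⊗ A`, the map `A ⟶ Φ(𝟙)` it induces. -/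
def freeLaxUnit (d : A.X ⟶ A.X ⊗ A.X) : A.X ⟶ (freeBimod A (𝟙_ C)).X :=
  d ≫ (ρ_ A.X).inv ▷ A.X

/-- The map `Φ(𝟙) ⟶ A` induced by the multiplication of `A`. -/
def freeOplaxCounit : (freeBimod A (𝟙_ C)).X ⟶ A.X :=
  (ρ_ A.X).hom ▷ A.X ≫ MonObj.mul

end General

/-! ### Group-theoretical categories and twisted Hecke algebras -/

section Hecke

variable {k G : Type u} [Field k] [Group G] [Fintype G] [DecidableEq G]
  {ω : Cocycle3 k G} {K L : Subgroup G}

/-- The group-theoretical category `C(G, ω, K, β)` of `A(K, β)`-bimodules in `Vec ω`. -/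
abbrev GTCat (β : Cochain2 ω K) :=
  Bimod (twistedGroupAlgebra β) (twistedGroupAlgebra β)

/-- The free functor `Φ : Vec ω ⥤ C(G, ω, K, β)`, `X ↦ (A(K, β) ⊗ X) ⊗ A(K, β)`. -/
abbrev Φ (β : Cochain2 ω K) : Vec ω ⥤ GTCat β := freeFunctor (twistedGroupAlgebra β)

/-- The object `A^{K, β}(L, ψ) = Φ(A(L, ψ))` of `C(G, ω, K, β)`. -/
abbrev hecke (β : Cochain2 ω K) (ψ : Cochain2 ω L) : GTCat β :=
  (Φ β).obj (twistedGroupAlgebra ψ).X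

/-- The inclusion of `(δ_f ⊗ δ_g) ⊗ δ_h` into the underlying object of `A^{K, β}(L, ψ)`. -/
def heckeι (β : Cochain2 ω K) (ψ : Cochain2 ω L) (f : K) (g : L) (h : K) :
    ((Vec.δ ω (f : G) ⊗ Vec.δ ω (g : G)) ⊗ Vec.δ ω (h : G)) ⟶ (hecke β ψ).X :=
  ((Vec.ofDegreesι (fun x : K => (x : G)) f ⊗ₘ Vec.ofDegreesι (fun x : L => (x : G)) g) ⊗ₘ
    Vec.ofDegreesι (fun x : K => (x : G)) h)

/-- The basis vector `δ_d` of `A(K, β)`, the unit object of `C(G, ω, K, β)`. -/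
def unitVec (β : Cochain2 ω K) (d : K) : (𝟙_ (GTCat β)).X.V :=
  (Finsupp.single d 1 : K →₀ k)

/-- The basis vector `(δ_f ⊗ δ_g) ⊗ δ_h` of `A^{K, β}(L, ψ)`. -/
def heckeVec (β : Cochain2 ω K) (ψ : Cochain2 ω L) (f : K) (g : L) (h : K) :
    (hecke β ψ).X.V :=
  ((Finsupp.single f 1 : K →₀ k) ⊗ₜ[k] (Finsupp.single g 1 : L →₀ k)) ⊗ₜ[k]
    (Finsupp.single h 1 : K →₀ k)

/-- The image of `m ⊗ n` in `M ⊗_A N`, for `A = A(K, β)`. -/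
def tmulOver {β : Cochain2 ω K} {M N : GTCat β} (m : M.X.V) (n : N.X.V) :
    (M ⊗ N : GTCat β).X.V :=
  (tensorπ M N).hom (m ⊗ₜ[k] n)

end Hecke

end
end TwistedHecke

open TwistedHecke

namespace TwistedHecke

/-! ### The projection onto the tensor product of bimodules -/

section TensorOver

variable {C : Type*} [Category C] [MonoidalCategory C] [HasCoequalizers C]
  [∀ X : C, PreservesColimitsOfSize.{0, 0} (tensorLeft X)]
  [∀ X : C, PreservesColimitsOfSize.{0, 0} (tensorRight X)] {A : Mon C}

/-! The free bimodule functor Φ is a Frobenius monoidal functor: it carries a lax and an oplax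
monoidal structure that are compatible with each other, so it sends Frobenius algebras to Frobenius
algebras. The theorem is this fact for A(L, ψ), evaluated on basis vectors.

The lax structure contracts the two inner copies of A by e ∘ m_A, and its unit is built from a map d
: A ⟶ A ⊗ A. Balancedness is associativity of m_A; the unit laws, and bimodule linearity of the
unit, hold when (d, e) makes A a Frobenius algebra. The oplax structure inserts d' ∘ u_A, and its
counit is m_A; the counit laws hold as soon as m_A d' u_A = u_A. Naturality, (co)associativity and
the compatibility of the two structures hold for arbitrary e and d', because the operations involved
act on disjoint tensor factors and commute by interchange. `freeFrobeniusBimodData` assembles all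
this.

So (d, e) and d' may be chosen independently, and (d, e) may be replaced by (c d, c⁻¹ e). Here d' =
Δ_A, which satisfies m_A Δ_A = id, and (d, e) = (|K| Δ_A, |K|⁻¹ ε_A). This choice of c removes the
scalars |K| of ε_A and |K|⁻¹ of Δ_A from the multiplication and the unit, and is the normalization
in the statement.

No computation takes place in a quotient. The comultiplication factors through P ⊗ P, so only the
multiplication has to descend to P ⊗_A P, and every axiom can be checked on underlying objects
(`FrobeniusBimodData`). For the twisted group algebras, the Frobenius identities and coassociativity
each come from one instance of dψ = ω. In the final formulas the four values of ω are the four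
associators in the (op)lax structure map (`freeLaxLift_apply`, `freeOplaxLift_apply`). -/

theorem tensorπ_hom_ext {M N : Bimod A A} {Z : C} {f g : (M ⊗ N : Bimod A A).X ⟶ Z}
    (h : tensorπ M N ≫ f = tensorπ M N ≫ g) : f = g :=
  coequalizer.hom_ext h

/-- Tensoring preserves coequalizers, so a whiskered projection is still an epimorphism. -/
theorem whiskerLeft_tensorπ_hom_ext {W : C} {M N : Bimod A A} {Z : C}
    {f g : W ⊗ (M ⊗ N : Bimod A A).X ⟶ Z}
    (h : W ◁ tensorπ M N ≫ f = W ◁ tensorπ M N ≫ g) : f = g :=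
  (cancel_epi ((tensorLeft W).map (coequalizer.π (M.actRight ▷ N.X)
    ((α_ _ _ _).hom ≫ (M.X ◁ N.actLeft))))).1 h

theorem tensorπ_whiskerRight_hom_ext {W : C} {M N : Bimod A A} {Z : C}
    {f g : (M ⊗ N : Bimod A A).X ⊗ W ⟶ Z}
    (h : tensorπ M N ▷ W ≫ f = tensorπ M N ▷ W ≫ g) : f = g :=
  (cancel_epi ((tensorRight W).map (coequalizer.π (M.actRight ▷ N.X)
    ((α_ _ _ _).hom ≫ (M.X ◁ N.actLeft))))).1 h

/-- The morphism out of `M ⊗_A N` induced by a balanced morphism. -/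
noncomputable def tensorDesc {M N : Bimod A A} {Z : C} (f : M.X ⊗ N.X ⟶ Z)
    (h : M.actRight ▷ N.X ≫ f = (α_ _ _ _).hom ≫ M.X ◁ N.actLeft ≫ f) :
    (M ⊗ N : Bimod A A).X ⟶ Z :=
  coequalizer.desc f (by rw [h, Category.assoc])

theorem tensorπ_desc {M N : Bimod A A} {Z : C} (f : M.X ⊗ N.X ⟶ Z)
    (h : M.actRight ▷ N.X ≫ f = (α_ _ _ _).hom ≫ M.X ◁ N.actLeft ≫ f) :
    tensorπ M N ≫ tensorDesc f h = f :=
  coequalizer.π_desc _ _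

theorem whiskerLeft_tensorπ_actLeft (M N : Bimod A A) :
    A.X ◁ tensorπ M N ≫ (M ⊗ N : Bimod A A).actLeft =
      (α_ _ _ _).inv ≫ M.actLeft ▷ N.X ≫ tensorπ M N :=
  Bimod.TensorBimod.whiskerLeft_π_actLeft M N

theorem tensorπ_whiskerRight_actRight (M N : Bimod A A) :
    tensorπ M N ▷ A.X ≫ (M ⊗ N : Bimod A A).actRight =
      (α_ _ _ _).hom ≫ M.X ◁ N.actRight ≫ tensorπ M N :=
  Bimod.TensorBimod.π_tensor_id_actRight M N

theorem tensorπ_whiskerLeft_hom (M : Bimod A A) {N N' : Bimod A A} (f : N ⟶ N') :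
    tensorπ M N ≫ (M ◁ f).hom = M.X ◁ f.hom ≫ tensorπ M N' :=
  ι_colimMap _ WalkingParallelPair.one

theorem tensorπ_whiskerRight_hom {M M' : Bimod A A} (f : M ⟶ M') (N : Bimod A A) :
    tensorπ M N ≫ (f ▷ N).hom = f.hom ▷ N.X ≫ tensorπ M' N :=
  ι_colimMap _ WalkingParallelPair.one

/-- The associator of bimodules is obtained by descending the ambient one along two projections.
This relation lets an identity over A be replaced by one between underlying objects. -/
theorem tensorπ_associator_hom (M N P : Bimod A A) :
    tensorπ M N ▷ P.X ≫ tensorπ (M ⊗ N) P ≫ (α_ M N P).hom.hom =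
      (α_ M.X N.X P.X).hom ≫ M.X ◁ tensorπ N P ≫ tensorπ M (N ⊗ P) := by
  have h : tensorπ (M ⊗ N) P ≫ (α_ M N P).hom.hom = Bimod.AssociatorBimod.homAux M N P :=
    coequalizer.π_desc _ _
  rw [h]
  exact π_tensor_id_preserves_coequalizer_inv_desc _ _ _ _

theorem tensorπ_associator_inv (M N P : Bimod A A) :
    M.X ◁ tensorπ N P ≫ tensorπ M (N ⊗ P) ≫ (α_ M N P).inv.hom =
      (α_ M.X N.X P.X).inv ≫ tensorπ M N ▷ P.X ≫ tensorπ (M ⊗ N) P := by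
  have h : tensorπ M (N ⊗ P) ≫ (α_ M N P).inv.hom = Bimod.AssociatorBimod.invAux M N P :=
    coequalizer.π_desc _ _
  rw [h]
  exact id_tensor_π_preserves_coequalizer_inv_desc _ _ _ _

/-- The unitors over A are induced by the actions, which therefore take the place of the unitors in
all identities on underlying objects. -/
theorem tensorπ_leftUnitor_hom (M : Bimod A A) :
    tensorπ (𝟙_ (Bimod A A)) M ≫ (λ_ M).hom.hom = M.actLeft :=
  coequalizer.π_desc _ _

theorem tensorπ_rightUnitor_hom (M : Bimod A A) :
    tensorπ M (𝟙_ (Bimod A A)) ≫ (ρ_ M).hom.hom = M.actRight :=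
  coequalizer.π_desc _ _

/-- A balanced morphism which is compatible with the outer actions induces a morphism of bimodules
out of `M ⊗_A N`. -/
@[simps]
noncomputable def tensorDescHom {M N P : Bimod A A} (f : M.X ⊗ N.X ⟶ P.X)
    (h : M.actRight ▷ N.X ≫ f = (α_ _ _ _).hom ≫ M.X ◁ N.actLeft ≫ f)
    (hl : (α_ _ _ _).inv ≫ M.actLeft ▷ N.X ≫ f = A.X ◁ f ≫ P.actLeft)
    (hr : (α_ _ _ _).hom ≫ M.X ◁ N.actRight ≫ f = f ▷ A.X ≫ P.actRight) :
    M ⊗ N ⟶ P where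
  hom := tensorDesc f h
  left_act_hom := by
    apply whiskerLeft_tensorπ_hom_ext
    rw [reassoc_of% whiskerLeft_tensorπ_actLeft, tensorπ_desc,
      ← whiskerLeft_comp_assoc, tensorπ_desc, hl]
  right_act_hom := by
    apply tensorπ_whiskerRight_hom_ext
    rw [reassoc_of% tensorπ_whiskerRight_actRight, tensorπ_desc, ← comp_whiskerRight_assoc,
      tensorπ_desc, hr]

/-- A morphism into `M ⊗ N` which is compatible with the outer actions induces a morphism of
bimodules into `M ⊗_A N`. -/
@[simps]
noncomputable def tensorLiftHom {M N P : Bimod A A} (f : P.X ⟶ M.X ⊗ N.X)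
    (hl : P.actLeft ≫ f = A.X ◁ f ≫ (α_ _ _ _).inv ≫ M.actLeft ▷ N.X)
    (hr : P.actRight ≫ f = f ▷ A.X ≫ (α_ _ _ _).hom ≫ M.X ◁ N.actRight) :
    P ⟶ M ⊗ N where
  hom := f ≫ tensorπ M N
  left_act_hom := by
    rw [reassoc_of% hl, MonoidalCategory.whiskerLeft_comp, Category.assoc,
      whiskerLeft_tensorπ_actLeft]
  right_act_hom := by
    rw [reassoc_of% hr, MonoidalCategory.comp_whiskerRight, Category.assoc,
      tensorπ_whiskerRight_actRight]

end TensorOver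

/-! ### Frobenius algebras in bimodules from morphisms between underlying objects -/

section FrobeniusBimod

variable {C : Type*} [Category C] [MonoidalCategory C]

/-- Structure morphisms on the underlying object of an `A`-bimodule which induce a Frobenius algebra
in `A`-bimodules. -/
structure FrobeniusBimodData {A : Mon C} (P : Bimod A A) where
  mul : P.X ⊗ P.X ⟶ P.X
  one : A.X ⟶ P.X
  comul : P.X ⟶ P.X ⊗ P.X
  counit : P.X ⟶ A.X
  mul_balanced : P.actRight ▷ P.X ≫ mul = (α_ _ _ _).hom ≫ P.X ◁ P.actLeft ≫ mul
  actLeft_mul : (α_ _ _ _).inv ≫ P.actLeft ▷ P.X ≫ mul = A.X ◁ mul ≫ P.actLeft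
  actRight_mul : (α_ _ _ _).hom ≫ P.X ◁ P.actRight ≫ mul = mul ▷ A.X ≫ P.actRight
  actLeft_one : MonObj.mul ≫ one = A.X ◁ one ≫ P.actLeft
  actRight_one : MonObj.mul ≫ one = one ▷ A.X ≫ P.actRight
  actLeft_comul : P.actLeft ≫ comul = A.X ◁ comul ≫ (α_ _ _ _).inv ≫ P.actLeft ▷ P.X
  actRight_comul : P.actRight ≫ comul = comul ▷ A.X ≫ (α_ _ _ _).hom ≫ P.X ◁ P.actRight
  actLeft_counit : P.actLeft ≫ counit = A.X ◁ counit ≫ MonObj.mul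
  actRight_counit : P.actRight ≫ counit = counit ▷ A.X ≫ MonObj.mul
  -- In the four (co)unit laws the actions play the role of the unitors of `Bimod A A`.
  one_mul : one ▷ P.X ≫ mul = P.actLeft
  mul_one : P.X ◁ one ≫ mul = P.actRight
  mul_assoc : mul ▷ P.X ≫ mul = (α_ _ _ _).hom ≫ P.X ◁ mul ≫ mul
  counit_comul : comul ≫ counit ▷ P.X ≫ P.actLeft = 𝟙 P.X
  comul_counit : comul ≫ P.X ◁ counit ≫ P.actRight = 𝟙 P.X
  -- Coassociativity and the Frobenius identities are imposed before projecting to ⊗_A. This is more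
  -- than a Frobenius algebra over A needs, but free bimodules satisfy it.
  comul_assoc : comul ≫ P.X ◁ comul = comul ≫ comul ▷ P.X ≫ (α_ _ _ _).hom
  frobenius_left : P.X ◁ comul ≫ (α_ _ _ _).inv ≫ mul ▷ P.X = mul ≫ comul
  frobenius_right : comul ▷ P.X ≫ (α_ _ _ _).hom ≫ P.X ◁ mul = mul ≫ comul

namespace FrobeniusBimodData

variable [HasCoequalizers C]
  [∀ X : C, PreservesColimitsOfSize.{0, 0} (tensorLeft X)]
  [∀ X : C, PreservesColimitsOfSize.{0, 0} (tensorRight X)] {A : Mon C} {P : Bimod A A}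

/-- The multiplication `P ⊗_A P ⟶ P`. -/
noncomputable def mulHom (F : FrobeniusBimodData P) : P ⊗ P ⟶ P :=
  tensorDescHom F.mul F.mul_balanced F.actLeft_mul F.actRight_mul

/-- The unit `A ⟶ P`. -/
def oneHom (F : FrobeniusBimodData P) : 𝟙_ (Bimod A A) ⟶ P where
  hom := F.one
  left_act_hom := F.actLeft_one
  right_act_hom := F.actRight_one

/-- The comultiplication `P ⟶ P ⊗_A P`. -/
noncomputable def comulHom (F : FrobeniusBimodData P) : P ⟶ P ⊗ P :=
  tensorLiftHom F.comul F.actLeft_comul F.actRight_comul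

/-- The counit `P ⟶ A`. -/
def counitHom (F : FrobeniusBimodData P) : P ⟶ 𝟙_ (Bimod A A) where
  hom := F.counit
  left_act_hom := F.actLeft_counit
  right_act_hom := F.actRight_counit

theorem tensorπ_mulHom (F : FrobeniusBimodData P) : tensorπ P P ≫ F.mulHom.hom = F.mul :=
  tensorπ_desc _ F.mul_balanced

theorem comulHom_hom (F : FrobeniusBimodData P) : F.comulHom.hom = F.comul ≫ tensorπ P P := rfl

/-- The Frobenius algebra in `A`-bimodules induced by `F`. -/
@[reducible]
noncomputable def frobeniusObj (F : FrobeniusBimodData P) : FrobeniusObj P where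
  mul := F.mulHom
  one := F.oneHom
  comul := F.comulHom
  counit := F.counitHom
  one_mul := by
    apply Bimod.hom_ext
    apply tensorπ_hom_ext
    rw [Bimod.comp_hom', reassoc_of% tensorπ_whiskerRight_hom, tensorπ_mulHom,
      tensorπ_leftUnitor_hom]
    exact F.one_mul
  mul_one := by
    apply Bimod.hom_ext
    apply tensorπ_hom_ext
    rw [Bimod.comp_hom', reassoc_of% tensorπ_whiskerLeft_hom, tensorπ_mulHom,
      tensorπ_rightUnitor_hom]
    exact F.mul_one
  mul_assoc := by
    apply Bimod.hom_ext
    -- The source is an iterated quotient of P ⊗ P ⊗ P, so two epimorphisms are cancelled.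
    apply tensorπ_hom_ext
    apply tensorπ_whiskerRight_hom_ext
    rw [Bimod.comp_hom', Bimod.comp_hom', Bimod.comp_hom', reassoc_of% tensorπ_whiskerRight_hom,
      reassoc_of% tensorπ_associator_hom, reassoc_of% tensorπ_whiskerLeft_hom, tensorπ_mulHom,
      ← MonoidalCategory.comp_whiskerRight_assoc, ← MonoidalCategory.whiskerLeft_comp_assoc,
      tensorπ_mulHom]
    exact F.mul_assoc
  counit_comul := by
    -- Only the forward unitor has a description through the projection, so the inverse is moved to
    -- the other side.
    rw [← cancel_mono (λ_ P).hom, Iso.inv_hom_id]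
    apply Bimod.hom_ext
    rw [Bimod.comp_hom', Bimod.comp_hom', comulHom_hom, Category.assoc, Category.assoc,
      reassoc_of% tensorπ_whiskerRight_hom, tensorπ_leftUnitor_hom]
    exact F.counit_comul
  comul_counit := by
    rw [← cancel_mono (ρ_ P).hom, Iso.inv_hom_id]
    apply Bimod.hom_ext
    rw [Bimod.comp_hom', Bimod.comp_hom', comulHom_hom, Category.assoc, Category.assoc,
      reassoc_of% tensorπ_whiskerLeft_hom, tensorπ_rightUnitor_hom]
    exact F.comul_counit
  comul_assoc := by
    apply Bimod.hom_ext
    rw [Bimod.comp_hom', Bimod.comp_hom', Bimod.comp_hom', comulHom_hom, Category.assoc,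
      Category.assoc, tensorπ_whiskerLeft_hom, reassoc_of% tensorπ_whiskerRight_hom, comulHom_hom,
      MonoidalCategory.whiskerLeft_comp, MonoidalCategory.comp_whiskerRight, Category.assoc,
      Category.assoc, tensorπ_associator_hom, reassoc_of% F.comul_assoc]
  frobenius_left := by
    apply Bimod.hom_ext
    apply tensorπ_hom_ext
    rw [Bimod.comp_hom', Bimod.comp_hom', Bimod.comp_hom', reassoc_of% tensorπ_whiskerLeft_hom,
      reassoc_of% tensorπ_mulHom, comulHom_hom, MonoidalCategory.whiskerLeft_comp, Category.assoc,
      reassoc_of% tensorπ_associator_inv, tensorπ_whiskerRight_hom,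
      ← MonoidalCategory.comp_whiskerRight_assoc, tensorπ_mulHom, reassoc_of% F.frobenius_left]
  frobenius_right := by
    apply Bimod.hom_ext
    apply tensorπ_hom_ext
    rw [Bimod.comp_hom', Bimod.comp_hom', Bimod.comp_hom', reassoc_of% tensorπ_whiskerRight_hom,
      reassoc_of% tensorπ_mulHom, comulHom_hom, MonoidalCategory.comp_whiskerRight, Category.assoc,
      reassoc_of% tensorπ_associator_hom, tensorπ_whiskerLeft_hom,
      ← MonoidalCategory.whiskerLeft_comp_assoc, tensorπ_mulHom, reassoc_of% F.frobenius_right]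

end FrobeniusBimodData

end FrobeniusBimod

/-! ### Lax and oplax structures of the free bimodule functor -/

section FreeBimod

variable {C : Type*} [Category C] [MonoidalCategory C] (A : Mon C)

open MonObj

/-- Isolates the only morphism that is not a coherence isomorphism. Later identities then reduce, up
to coherence, to one interchange or to one algebra axiom of A. -/
theorem freeLaxLift_eq (ε : A.X ⟶ 𝟙_ C) (X Y : C) :
    freeLaxLift A ε X Y =
      𝟙 _ ⊗≫ (A.X ⊗ X) ◁ (μ[A.X] ≫ ε) ▷ (Y ⊗ A.X) ⊗≫ 𝟙 _ := by
  dsimp only [freeLaxLift]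
  monoidal

theorem freeOplaxLift_eq (d : A.X ⟶ A.X ⊗ A.X) (X Y : C) :
    freeOplaxLift A d X Y =
      𝟙 _ ⊗≫ (A.X ⊗ X) ◁ (η[A.X] ≫ d) ▷ (Y ⊗ A.X) ⊗≫ 𝟙 _ := by
  dsimp only [freeOplaxLift]
  monoidal

theorem freeLaxLift_naturality_left (ε : A.X ⟶ 𝟙_ C) {X X' : C} (f : X ⟶ X') (Y : C) :
    ((A.X ◁ f) ▷ A.X) ▷ (freeBimod A Y).X ≫ freeLaxLift A ε X' Y =
      freeLaxLift A ε X Y ≫ (A.X ◁ f ▷ Y) ▷ A.X := by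
  rw [freeLaxLift_eq, freeLaxLift_eq]
  calc
    _ = 𝟙 _ ⊗≫ A.X ◁ (f ▷ (A.X ⊗ A.X) ≫ X' ◁ (μ[A.X] ≫ ε)) ▷ (Y ⊗ A.X) ⊗≫ 𝟙 _ := by monoidal
    _ = _ := by rw [← whisker_exchange]; monoidal

theorem freeLaxLift_naturality_right (ε : A.X ⟶ 𝟙_ C) (X : C) {Y Y' : C} (f : Y ⟶ Y') :
    (freeBimod A X).X ◁ ((A.X ◁ f) ▷ A.X) ≫ freeLaxLift A ε X Y' =
      freeLaxLift A ε X Y ≫ (A.X ◁ X ◁ f) ▷ A.X := by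
  rw [freeLaxLift_eq, freeLaxLift_eq]
  calc
    _ = 𝟙 _ ⊗≫ (A.X ⊗ X) ◁ ((A.X ⊗ A.X) ◁ f ≫ (μ[A.X] ≫ ε) ▷ Y') ▷ A.X ⊗≫ 𝟙 _ := by
      monoidal
    _ = _ := by rw [whisker_exchange]; monoidal

theorem freeOplaxLift_naturality_left (d : A.X ⟶ A.X ⊗ A.X) {X X' : C} (f : X ⟶ X') (Y : C) :
    freeOplaxLift A d X Y ≫ ((A.X ◁ f) ▷ A.X) ▷ (freeBimod A Y).X =
      (A.X ◁ f ▷ Y) ▷ A.X ≫ freeOplaxLift A d X' Y := by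
  rw [freeOplaxLift_eq, freeOplaxLift_eq]
  symm
  calc
    _ = 𝟙 _ ⊗≫ A.X ◁ (f ▷ 𝟙_ C ≫ X' ◁ (η[A.X] ≫ d)) ▷ (Y ⊗ A.X) ⊗≫ 𝟙 _ := by monoidal
    _ = _ := by rw [← whisker_exchange]; monoidal

theorem freeOplaxLift_naturality_right (d : A.X ⟶ A.X ⊗ A.X) (X : C) {Y Y' : C} (f : Y ⟶ Y') :
    freeOplaxLift A d X Y ≫ (freeBimod A X).X ◁ ((A.X ◁ f) ▷ A.X) =
      (A.X ◁ X ◁ f) ▷ A.X ≫ freeOplaxLift A d X Y' := by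
  rw [freeOplaxLift_eq, freeOplaxLift_eq]
  symm
  calc
    _ = 𝟙 _ ⊗≫ (A.X ⊗ X) ◁ (𝟙_ C ◁ f ≫ (η[A.X] ≫ d) ▷ Y') ▷ A.X ⊗≫ 𝟙 _ := by
      monoidal
    _ = _ := by rw [whisker_exchange]; monoidal

/-- Moving the middle copy of A from one side to the other is associativity of m_A inside the
contraction; nothing is asked of ε. -/
theorem freeLaxLift_balanced (ε : A.X ⟶ 𝟙_ C) (X Y : C) :
    (freeBimod A X).actRight ▷ (freeBimod A Y).X ≫ freeLaxLift A ε X Y =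
      (α_ _ _ _).hom ≫ (freeBimod A X).X ◁ (freeBimod A Y).actLeft ≫ freeLaxLift A ε X Y := by
  rw [freeLaxLift_eq]
  dsimp only [freeBimod]
  calc
    _ = 𝟙 _ ⊗≫ (A.X ⊗ X) ◁ (μ[A.X] ▷ A.X ≫ μ[A.X]) ▷ (Y ⊗ A.X) ⊗≫
        (A.X ⊗ X) ◁ ε ▷ (Y ⊗ A.X) ⊗≫ 𝟙 _ := by monoidal
    _ = _ := by rw [MonObj.mul_assoc]; monoidal

/-- The outer multiplication and the inner contraction touch different tensor factors. The same
reason gives the other linearity statements for the lax and oplax maps. -/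
theorem freeLaxLift_actLeft (ε : A.X ⟶ 𝟙_ C) (X Y : C) :
    (α_ _ _ _).inv ≫ (freeBimod A X).actLeft ▷ (freeBimod A Y).X ≫ freeLaxLift A ε X Y =
      A.X ◁ freeLaxLift A ε X Y ≫ (freeBimod A (X ⊗ Y)).actLeft := by
  rw [freeLaxLift_eq]
  dsimp only [freeBimod]
  calc
    _ = 𝟙 _ ⊗≫ (μ[A.X] ▷ (X ⊗ A.X ⊗ A.X) ≫ A.X ◁ X ◁ (μ[A.X] ≫ ε)) ▷ (Y ⊗ A.X) ⊗≫ 𝟙 _ := by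
      monoidal
    _ = _ := by rw [← whisker_exchange]; monoidal

theorem freeLaxLift_actRight (ε : A.X ⟶ 𝟙_ C) (X Y : C) :
    (α_ _ _ _).hom ≫ (freeBimod A X).X ◁ (freeBimod A Y).actRight ≫ freeLaxLift A ε X Y =
      freeLaxLift A ε X Y ▷ A.X ≫ (freeBimod A (X ⊗ Y)).actRight := by
  rw [freeLaxLift_eq]
  dsimp only [freeBimod]
  calc
    _ = 𝟙 _ ⊗≫ (A.X ⊗ X) ◁ ((A.X ⊗ A.X) ◁ (Y ◁ μ[A.X]) ≫ (μ[A.X] ≫ ε) ▷ (Y ⊗ A.X)) ⊗≫ 𝟙 _ := by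
      monoidal
    _ = _ := by rw [whisker_exchange]; monoidal

theorem freeOplaxLift_actLeft (d : A.X ⟶ A.X ⊗ A.X) (X Y : C) :
    (freeBimod A (X ⊗ Y)).actLeft ≫ freeOplaxLift A d X Y =
      A.X ◁ freeOplaxLift A d X Y ≫ (α_ _ _ _).inv ≫
        (freeBimod A X).actLeft ▷ (freeBimod A Y).X := by
  rw [freeOplaxLift_eq]
  dsimp only [freeBimod]
  calc
    _ = 𝟙 _ ⊗≫ (μ[A.X] ▷ (X ⊗ 𝟙_ C) ≫ A.X ◁ X ◁ (η[A.X] ≫ d)) ▷ (Y ⊗ A.X) ⊗≫ 𝟙 _ := by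
      monoidal
    _ = _ := by rw [← whisker_exchange]; monoidal

theorem freeOplaxLift_actRight (d : A.X ⟶ A.X ⊗ A.X) (X Y : C) :
    (freeBimod A (X ⊗ Y)).actRight ≫ freeOplaxLift A d X Y =
      freeOplaxLift A d X Y ▷ A.X ≫ (α_ _ _ _).hom ≫
        (freeBimod A X).X ◁ (freeBimod A Y).actRight := by
  rw [freeOplaxLift_eq]
  dsimp only [freeBimod]
  calc
    _ = 𝟙 _ ⊗≫ (A.X ⊗ X) ◁ (𝟙_ C ◁ (Y ◁ μ[A.X]) ≫ (η[A.X] ≫ d) ▷ (Y ⊗ A.X)) ⊗≫ 𝟙 _ := by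
      monoidal
    _ = _ := by rw [whisker_exchange]; monoidal

/-- Both sides perform two contractions, one on each side of Y, in opposite orders. -/
theorem freeLaxLift_associativity (ε : A.X ⟶ 𝟙_ C) (X Y Z : C) :
    freeLaxLift A ε X Y ▷ (freeBimod A Z).X ≫ freeLaxLift A ε (X ⊗ Y) Z ≫
        (A.X ◁ (α_ X Y Z).hom) ▷ A.X =
      (α_ _ _ _).hom ≫ (freeBimod A X).X ◁ freeLaxLift A ε Y Z ≫
        freeLaxLift A ε X (Y ⊗ Z) := by
  simp only [freeLaxLift_eq]
  calc
    _ = 𝟙 _ ⊗≫ (A.X ⊗ X) ◁ ((μ[A.X] ≫ ε) ▷ (Y ⊗ (A.X ⊗ A.X)) ≫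
        𝟙_ C ◁ (Y ◁ (μ[A.X] ≫ ε))) ▷ (Z ⊗ A.X) ⊗≫ 𝟙 _ := by
      monoidal
    _ = _ := by rw [← whisker_exchange]; monoidal

theorem freeOplaxLift_associativity (d : A.X ⟶ A.X ⊗ A.X) (X Y Z : C) :
    (A.X ◁ (α_ X Y Z).hom) ▷ A.X ≫ freeOplaxLift A d X (Y ⊗ Z) ≫
        (freeBimod A X).X ◁ freeOplaxLift A d Y Z =
      freeOplaxLift A d (X ⊗ Y) Z ≫ freeOplaxLift A d X Y ▷ (freeBimod A Z).X ≫
        (α_ _ _ _).hom := by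
  simp only [freeOplaxLift_eq]
  calc
    _ = 𝟙 _ ⊗≫ (A.X ⊗ X) ◁ ((η[A.X] ≫ d) ▷ (Y ⊗ 𝟙_ C) ≫
        (A.X ⊗ A.X) ◁ (Y ◁ (η[A.X] ≫ d))) ▷ (Z ⊗ A.X) ⊗≫ 𝟙 _ := by
      monoidal
    _ = _ := by rw [← whisker_exchange]; monoidal

/-- The compatibility that makes Φ a Frobenius functor: contracting between X and Y commutes with
inserting between Y and Z. It needs no relation between ε and d. -/
theorem freeOplaxLift_freeLaxLift_left (ε : A.X ⟶ 𝟙_ C) (d : A.X ⟶ A.X ⊗ A.X) (X Y Z : C) :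
    (freeBimod A X).X ◁ freeOplaxLift A d Y Z ≫ (α_ _ _ _).inv ≫
        freeLaxLift A ε X Y ▷ (freeBimod A Z).X =
      freeLaxLift A ε X (Y ⊗ Z) ≫ (A.X ◁ (α_ X Y Z).inv) ▷ A.X ≫
        freeOplaxLift A d (X ⊗ Y) Z := by
  simp only [freeLaxLift_eq, freeOplaxLift_eq]
  symm
  calc
    _ = 𝟙 _ ⊗≫ (A.X ⊗ X) ◁ ((μ[A.X] ≫ ε) ▷ (Y ⊗ 𝟙_ C) ≫
        𝟙_ C ◁ (Y ◁ (η[A.X] ≫ d))) ▷ (Z ⊗ A.X) ⊗≫ 𝟙 _ := by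
      monoidal
    _ = _ := by rw [← whisker_exchange]; monoidal

theorem freeOplaxLift_freeLaxLift_right (ε : A.X ⟶ 𝟙_ C) (d : A.X ⟶ A.X ⊗ A.X) (X Y Z : C) :
    freeOplaxLift A d X Y ▷ (freeBimod A Z).X ≫ (α_ _ _ _).hom ≫
        (freeBimod A X).X ◁ freeLaxLift A ε Y Z =
      freeLaxLift A ε (X ⊗ Y) Z ≫ (A.X ◁ (α_ X Y Z).hom) ▷ A.X ≫
        freeOplaxLift A d X (Y ⊗ Z) := by
  simp only [freeLaxLift_eq, freeOplaxLift_eq]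
  symm
  calc
    _ = 𝟙 _ ⊗≫ (A.X ⊗ X) ◁ (𝟙_ C ◁ (Y ◁ (μ[A.X] ≫ ε)) ≫
        (η[A.X] ≫ d) ▷ (Y ⊗ 𝟙_ C)) ▷ (Z ⊗ A.X) ⊗≫ 𝟙 _ := by
      monoidal
    _ = _ := by rw [whisker_exchange]; monoidal

/-- The hypothesis says that d is left A-linear; the inserted unit object does not interfere. -/
theorem freeLaxUnit_actLeft (d : A.X ⟶ A.X ⊗ A.X)
    (hd : A.X ◁ d ≫ (α_ _ _ _).inv ≫ μ[A.X] ▷ A.X = μ[A.X] ≫ d) :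
    μ[A.X] ≫ freeLaxUnit A d = A.X ◁ freeLaxUnit A d ≫ (freeBimod A (𝟙_ C)).actLeft := by
  dsimp only [freeBimod, freeLaxUnit]
  rw [← reassoc_of% hd]
  monoidal

theorem freeLaxUnit_actRight (d : A.X ⟶ A.X ⊗ A.X)
    (hd : d ▷ A.X ≫ (α_ _ _ _).hom ≫ A.X ◁ μ[A.X] = μ[A.X] ≫ d) :
    μ[A.X] ≫ freeLaxUnit A d = freeLaxUnit A d ▷ A.X ≫ (freeBimod A (𝟙_ C)).actRight := by
  dsimp only [freeBimod, freeLaxUnit]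
  rw [← reassoc_of% hd]
  calc
    _ = d ▷ A.X ⊗≫ A.X ◁ μ[A.X] ⊗≫ 𝟙 _ := by monoidal
    _ = _ := by monoidal

theorem freeOplaxCounit_actLeft :
    (freeBimod A (𝟙_ C)).actLeft ≫ freeOplaxCounit A = A.X ◁ freeOplaxCounit A ≫ μ[A.X] := by
  dsimp only [freeBimod, freeOplaxCounit]
  calc
    _ = 𝟙 _ ⊗≫ (μ[A.X] ▷ A.X ≫ μ[A.X]) := by monoidal
    _ = _ := by rw [MonObj.mul_assoc]; monoidal

theorem freeOplaxCounit_actRight :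
    (freeBimod A (𝟙_ C)).actRight ≫ freeOplaxCounit A = freeOplaxCounit A ▷ A.X ≫ μ[A.X] := by
  dsimp only [freeBimod, freeOplaxCounit]
  symm
  calc
    _ = 𝟙 _ ⊗≫ (μ[A.X] ▷ A.X ≫ μ[A.X]) := by monoidal
    _ = _ := by rw [MonObj.mul_assoc]; monoidal

/-- By the Frobenius identity, multiplying the second leg of d(a) by b gives d(ab); the contraction
ε then removes the second leg by the counit law. -/
theorem freeLaxLift_left_unitality (ε : A.X ⟶ 𝟙_ C) (d : A.X ⟶ A.X ⊗ A.X)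
    (hd : d ▷ A.X ≫ (α_ _ _ _).hom ≫ A.X ◁ μ[A.X] = μ[A.X] ≫ d)
    (hε : d ≫ A.X ◁ ε = (ρ_ A.X).inv) (X : C) :
    freeLaxUnit A d ▷ (freeBimod A X).X ≫ freeLaxLift A ε (𝟙_ C) X ≫ (A.X ◁ (λ_ X).hom) ▷ A.X =
      (freeBimod A X).actLeft := by
  rw [freeLaxLift_eq]
  dsimp only [freeBimod, freeLaxUnit]
  calc
    _ = 𝟙 _ ⊗≫ (d ▷ A.X ≫ (α_ _ _ _).hom ≫ A.X ◁ μ[A.X]) ▷ (X ⊗ A.X) ⊗≫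
        (A.X ◁ ε) ▷ (X ⊗ A.X) ⊗≫ 𝟙 _ := by monoidal
    _ = 𝟙 _ ⊗≫ (μ[A.X] ≫ (d ≫ A.X ◁ ε)) ▷ (X ⊗ A.X) ⊗≫ 𝟙 _ := by rw [hd]; monoidal
    _ = _ := by rw [hε]; monoidal

theorem freeLaxLift_right_unitality (ε : A.X ⟶ 𝟙_ C) (d : A.X ⟶ A.X ⊗ A.X)
    (hd : A.X ◁ d ≫ (α_ _ _ _).inv ≫ μ[A.X] ▷ A.X = μ[A.X] ≫ d)
    (hε : d ≫ ε ▷ A.X = (λ_ A.X).inv) (X : C) :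
    (freeBimod A X).X ◁ freeLaxUnit A d ≫ freeLaxLift A ε X (𝟙_ C) ≫ (A.X ◁ (ρ_ X).hom) ▷ A.X =
      (freeBimod A X).actRight := by
  rw [freeLaxLift_eq]
  dsimp only [freeBimod, freeLaxUnit]
  calc
    _ = 𝟙 _ ⊗≫ (A.X ⊗ X) ◁ (A.X ◁ d ≫ (α_ _ _ _).inv ≫ μ[A.X] ▷ A.X) ⊗≫
        (A.X ⊗ X) ◁ (ε ▷ A.X) ⊗≫ 𝟙 _ := by monoidal
    _ = 𝟙 _ ⊗≫ (A.X ⊗ X) ◁ (μ[A.X] ≫ (d ≫ ε ▷ A.X)) ⊗≫ 𝟙 _ := by rw [hd]; monoidal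
    _ = _ := by rw [hε]; monoidal

/-- After reassociating, the inserted element d(1) is multiplied out first, which gives 1 by
hypothesis, and the outer copy of A is multiplied by 1. -/
theorem freeOplaxLift_left_counitality (d : A.X ⟶ A.X ⊗ A.X) (hd : η[A.X] ≫ d ≫ μ[A.X] = η[A.X])
    (X : C) :
    freeOplaxLift A d (𝟙_ C) X ≫ freeOplaxCounit A ▷ (freeBimod A X).X ≫
        (freeBimod A X).actLeft = (A.X ◁ (λ_ X).hom) ▷ A.X := by
  rw [freeOplaxLift_eq]
  dsimp only [freeBimod, freeOplaxCounit]
  calc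
    _ = 𝟙 _ ⊗≫ (A.X ◁ (η[A.X] ≫ d)) ▷ (X ⊗ A.X) ⊗≫
        (μ[A.X] ▷ A.X ≫ μ[A.X]) ▷ (X ⊗ A.X) ⊗≫ 𝟙 _ := by monoidal
    _ = 𝟙 _ ⊗≫ (A.X ◁ (η[A.X] ≫ d ≫ μ[A.X]) ≫ μ[A.X]) ▷ (X ⊗ A.X) ⊗≫ 𝟙 _ := by
      rw [MonObj.mul_assoc]; monoidal
    _ = _ := by rw [hd, MonObj.mul_one]; monoidal

theorem freeOplaxLift_right_counitality (d : A.X ⟶ A.X ⊗ A.X)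
    (hd : η[A.X] ≫ d ≫ μ[A.X] = η[A.X]) (X : C) :
    freeOplaxLift A d X (𝟙_ C) ≫ (freeBimod A X).X ◁ freeOplaxCounit A ≫
        (freeBimod A X).actRight = (A.X ◁ (ρ_ X).hom) ▷ A.X := by
  rw [freeOplaxLift_eq]
  dsimp only [freeBimod, freeOplaxCounit]
  calc
    _ = 𝟙 _ ⊗≫ (A.X ⊗ X) ◁ ((η[A.X] ≫ d) ▷ A.X) ⊗≫
        (A.X ⊗ X) ◁ ((α_ A.X A.X A.X).hom ≫ A.X ◁ μ[A.X] ≫ μ[A.X]) ⊗≫ 𝟙 _ := by monoidal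
    _ = 𝟙 _ ⊗≫ (A.X ⊗ X) ◁ ((η[A.X] ≫ d ≫ μ[A.X]) ▷ A.X ≫ μ[A.X]) ⊗≫ 𝟙 _ := by
      rw [← MonObj.mul_assoc]; monoidal
    _ = _ := by rw [hd, MonObj.one_mul]; monoidal

end FreeBimod

/-! ### The free bimodule on a Frobenius algebra -/

section FreeFrobenius

variable {C : Type*} [Category C] [MonoidalCategory C] (A : Mon C)

open MonObj ComonObj

theorem whiskerLeft_whiskerRight_comp (Z : C) {X Y W : C} (f : X ⟶ Y) (g : Y ⟶ W) :
    (Z ◁ f) ▷ Z ≫ (Z ◁ g) ▷ Z = (Z ◁ (f ≫ g)) ▷ Z := by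
  simp

theorem freeBimod_map_actLeft {X Y : C} (f : X ⟶ Y) :
    (freeBimod A X).actLeft ≫ (A.X ◁ f) ▷ A.X =
      A.X ◁ ((A.X ◁ f) ▷ A.X) ≫ (freeBimod A Y).actLeft :=
  ((freeFunctor A).map f).left_act_hom

theorem freeBimod_map_actRight {X Y : C} (f : X ⟶ Y) :
    (freeBimod A X).actRight ≫ (A.X ◁ f) ▷ A.X =
      ((A.X ◁ f) ▷ A.X) ▷ A.X ≫ (freeBimod A Y).actRight :=
  ((freeFunctor A).map f).right_act_hom

/-- If `d` and `e` are a comultiplication and a counit making `A` a Frobenius algebra, and `d'`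
satisfies `m_A d' u_A = u_A`, then the free bimodule functor sends Frobenius algebras to Frobenius
algebras. -/
def freeFrobeniusBimodData (e : A.X ⟶ 𝟙_ C) (d d' : A.X ⟶ A.X ⊗ A.X)
    (hl : A.X ◁ d ≫ (α_ _ _ _).inv ≫ μ[A.X] ▷ A.X = μ[A.X] ≫ d)
    (hr : d ▷ A.X ≫ (α_ _ _ _).hom ≫ A.X ◁ μ[A.X] = μ[A.X] ≫ d)
    (hel : d ≫ e ▷ A.X = (λ_ A.X).inv) (her : d ≫ A.X ◁ e = (ρ_ A.X).inv)
    (hd' : η[A.X] ≫ d' ≫ μ[A.X] = η[A.X]) (B : C) [FrobeniusObj B] :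
    FrobeniusBimodData (freeBimod A B) where
  mul := freeLaxLift A e B B ≫ (A.X ◁ μ[B]) ▷ A.X
  one := freeLaxUnit A d ≫ (A.X ◁ η[B]) ▷ A.X
  comul := (A.X ◁ Δ[B]) ▷ A.X ≫ freeOplaxLift A d' B B
  counit := (A.X ◁ ε[B]) ▷ A.X ≫ freeOplaxCounit A
  mul_balanced := by
    rw [← Category.assoc, freeLaxLift_balanced, Category.assoc, Category.assoc]
  actLeft_mul := by
    rw [← Category.assoc ((freeBimod A B).actLeft ▷ _), ← Category.assoc (α_ _ _ _).inv,
      freeLaxLift_actLeft, Category.assoc, freeBimod_map_actLeft, whiskerLeft_comp, Category.assoc]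
  actRight_mul := by
    rw [← Category.assoc (_ ◁ (freeBimod A B).actRight), ← Category.assoc (α_ _ _ _).hom,
      freeLaxLift_actRight, Category.assoc, freeBimod_map_actRight, comp_whiskerRight,
      Category.assoc]
  actLeft_one := by
    rw [← Category.assoc, freeLaxUnit_actLeft A d hl, Category.assoc, freeBimod_map_actLeft,
      whiskerLeft_comp, Category.assoc]
  actRight_one := by
    rw [← Category.assoc, freeLaxUnit_actRight A d hr, Category.assoc, freeBimod_map_actRight,
      comp_whiskerRight, Category.assoc]
  actLeft_comul := by
    rw [← Category.assoc, freeBimod_map_actLeft, Category.assoc, freeOplaxLift_actLeft,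
      whiskerLeft_comp, Category.assoc]
  actRight_comul := by
    rw [← Category.assoc, freeBimod_map_actRight, Category.assoc, freeOplaxLift_actRight,
      comp_whiskerRight, Category.assoc]
  actLeft_counit := by
    rw [← Category.assoc, freeBimod_map_actLeft, Category.assoc, freeOplaxCounit_actLeft,
      whiskerLeft_comp, Category.assoc]
  actRight_counit := by
    rw [← Category.assoc, freeBimod_map_actRight, Category.assoc, freeOplaxCounit_actRight,
      comp_whiskerRight, Category.assoc]
  one_mul := by
    rw [comp_whiskerRight, Category.assoc, reassoc_of% freeLaxLift_naturality_left,
      whiskerLeft_whiskerRight_comp, MonObj.one_mul, freeLaxLift_left_unitality A e d hr her]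
  mul_one := by
    rw [whiskerLeft_comp, Category.assoc, reassoc_of% freeLaxLift_naturality_right,
      whiskerLeft_whiskerRight_comp, MonObj.mul_one, freeLaxLift_right_unitality A e d hl hel]
  mul_assoc := by
    -- Naturality moves both multiplications of B behind the contractions, where associativity of B
    -- meets associativity of the lax structure.
    rw [comp_whiskerRight, Category.assoc, reassoc_of% freeLaxLift_naturality_left,
      whiskerLeft_whiskerRight_comp, MonObj.mul_assoc, whiskerLeft_comp (freeBimod A B).X,
      Category.assoc,
      reassoc_of% freeLaxLift_naturality_right, whiskerLeft_whiskerRight_comp,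
      ← whiskerLeft_whiskerRight_comp, reassoc_of% freeLaxLift_associativity]
  counit_comul := by
    rw [comp_whiskerRight, Category.assoc, Category.assoc,
      reassoc_of% freeOplaxLift_naturality_left, freeOplaxLift_left_counitality A d' hd',
      whiskerLeft_whiskerRight_comp, whiskerLeft_whiskerRight_comp, reassoc_of% counit_comul,
      Iso.inv_hom_id, whiskerLeft_id, id_whiskerRight]
  comul_counit := by
    rw [whiskerLeft_comp, Category.assoc, Category.assoc,
      reassoc_of% freeOplaxLift_naturality_right, freeOplaxLift_right_counitality A d' hd',
      whiskerLeft_whiskerRight_comp, whiskerLeft_whiskerRight_comp, reassoc_of% comul_counit,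
      Iso.inv_hom_id, whiskerLeft_id, id_whiskerRight]
  comul_assoc := by
    rw [whiskerLeft_comp, Category.assoc, reassoc_of% freeOplaxLift_naturality_right,
      reassoc_of% whiskerLeft_whiskerRight_comp, comul_assoc, comp_whiskerRight, Category.assoc,
      Category.assoc, reassoc_of% freeOplaxLift_naturality_left,
      ← freeOplaxLift_associativity, reassoc_of% whiskerLeft_whiskerRight_comp,
      reassoc_of% whiskerLeft_whiskerRight_comp, Category.assoc]
  frobenius_left := by
    -- Commuting insertion past contraction and using naturality turns the claim into the image
    -- under Φ of the Frobenius identity of B.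
    rw [whiskerLeft_comp, comp_whiskerRight, Category.assoc,
      reassoc_of% freeOplaxLift_freeLaxLift_left, reassoc_of% freeLaxLift_naturality_right,
      freeOplaxLift_naturality_left, reassoc_of% whiskerLeft_whiskerRight_comp,
      reassoc_of% whiskerLeft_whiskerRight_comp, Category.assoc, FrobeniusObj.frobenius_left,
      Category.assoc, reassoc_of% whiskerLeft_whiskerRight_comp]
  frobenius_right := by
    rw [whiskerLeft_comp, comp_whiskerRight, Category.assoc,
      reassoc_of% freeOplaxLift_freeLaxLift_right, reassoc_of% freeLaxLift_naturality_left,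
      freeOplaxLift_naturality_right, reassoc_of% whiskerLeft_whiskerRight_comp,
      reassoc_of% whiskerLeft_whiskerRight_comp, Category.assoc, FrobeniusObj.frobenius_right,
      Category.assoc, reassoc_of% whiskerLeft_whiskerRight_comp]

end FreeFrobenius

open Vec

/-! ### The Frobenius structure of twisted group algebras -/

section TwistedGroupAlgebra

variable {k G : Type u} [Field k] [Group G] [Fintype G] [DecidableEq G]
  {ω : Cocycle3 k G} {L : Subgroup G}

theorem assocHom_single (K L M : Subgroup G) (a : K) (b : L) (c : M) :
    assocHom (groupObj ω K) (groupObj ω L) (groupObj ω M)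
        ((Finsupp.single a (1 : k) ⊗ₜ[k] Finsupp.single b (1 : k)) ⊗ₜ[k] Finsupp.single c (1 : k)) =
      (((ω a b c)⁻¹ : kˣ) : k) •
        (Finsupp.single a (1 : k) ⊗ₜ[k] (Finsupp.single b (1 : k) ⊗ₜ[k] Finsupp.single c (1 : k))) :=
  assocHom_apply (homog_single _ a 1) (homog_single _ b 1) (homog_single _ c 1)

theorem assocInv_single (K L M : Subgroup G) (a : K) (b : L) (c : M) :
    assocInv (groupObj ω K) (groupObj ω L) (groupObj ω M)
        (Finsupp.single a (1 : k) ⊗ₜ[k] (Finsupp.single b (1 : k) ⊗ₜ[k] Finsupp.single c (1 : k))) =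
      ((ω a b c : kˣ) : k) •
        ((Finsupp.single a (1 : k) ⊗ₜ[k] Finsupp.single b (1 : k)) ⊗ₜ[k] Finsupp.single c (1 : k)) :=
  assocInv_apply (homog_single _ a 1) (homog_single _ b 1) (homog_single _ c 1)

theorem twistedComul_single [Fintype L] (ψ : Cochain2 ω L) (g : L) :
    (twistedComul ψ).hom (Finsupp.single g (1 : k)) = (Fintype.card L : k)⁻¹ •
      ∑ h : L, (((ψ (g * h) h⁻¹)⁻¹ : kˣ) : k) •
        (Finsupp.single (g * h) (1 : k) ⊗ₜ[k] Finsupp.single h⁻¹ (1 : k)) := by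
  refine (Finsupp.linearCombination_single k 1 g).trans ?_
  rw [one_smul]

theorem twistedCounit_single [Fintype L] (g : L) :
    (twistedCounit ω L).hom (Finsupp.single g (1 : k)) =
      if g = 1 then (Fintype.card L : k) else 0 := by
  refine (Finsupp.linearCombination_single k 1 g).trans ?_
  rw [one_smul]

theorem twistedComul_frobenius_left [Fintype L] (ψ : Cochain2 ω L) :
    groupObj ω L ◁ twistedComul ψ ≫ (α_ _ _ _).inv ≫ twistedMul ψ ▷ groupObj ω L =
      twistedMul ψ ≫ twistedComul ψ := by
  apply hom_ext
  apply ext_single₂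
  intro a b
  change TensorProduct.map (twistedMul ψ).hom LinearMap.id (assocInv _ _ _
    (Finsupp.single a 1 ⊗ₜ[k] (twistedComul ψ).hom (Finsupp.single b 1))) =
      (twistedComul ψ).hom ((twistedMul ψ).hom
        (Finsupp.single a (1 : k) ⊗ₜ[k] Finsupp.single b (1 : k)))
  simp -dsimp only [twistedMul_single, map_smul, twistedComul_single, TensorProduct.tmul_smul,
    TensorProduct.tmul_sum, map_sum, assocInv_single, TensorProduct.map_tmul,
    ← TensorProduct.smul_tmul', smul_smul, LinearMap.id_apply, Finset.smul_sum]
  refine Finset.sum_congr rfl fun h _ => ?_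
  rw [assocInv_single, map_smul, TensorProduct.map_tmul, twistedMul_single, LinearMap.id_apply,
    ← TensorProduct.smul_tmul', smul_smul, smul_smul, ← mul_assoc a b h]
  congr 1
  -- The triple is that of the associator. As (b h) h⁻¹ = b, this relation compares the summands for
  -- the same h.
  have := congrArg Units.val (ψ.coboundary a (b * h) h⁻¹)
  simp only [Units.val_mul, mul_inv_cancel_right, ← mul_assoc a b h] at this
  simp only [Units.val_inv_eq_inv_val, Subgroup.coe_mul, InvMemClass.coe_inv] at this ⊢
  generalize (Fintype.card L : k)⁻¹ = c
  field_simp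
  linear_combination -c * this

theorem twistedComul_frobenius_right [Fintype L] (ψ : Cochain2 ω L) :
    twistedComul ψ ▷ groupObj ω L ≫ (α_ _ _ _).hom ≫ groupObj ω L ◁ twistedMul ψ =
      twistedMul ψ ≫ twistedComul ψ := by
  apply hom_ext
  apply ext_single₂
  intro a b
  change TensorProduct.map LinearMap.id (twistedMul ψ).hom (assocHom _ _ _
    ((twistedComul ψ).hom (Finsupp.single a 1) ⊗ₜ[k] Finsupp.single b 1)) =
      (twistedComul ψ).hom ((twistedMul ψ).hom
        (Finsupp.single a (1 : k) ⊗ₜ[k] Finsupp.single b (1 : k)))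
  simp -dsimp only [twistedMul_single, map_smul, twistedComul_single, TensorProduct.tmul_smul,
    TensorProduct.sum_tmul, map_sum, assocHom_single, TensorProduct.map_tmul,
    ← TensorProduct.smul_tmul', smul_smul, LinearMap.id_apply, Finset.smul_sum]
  -- The term δ_{ah} ⊗ δ_{h⁻¹b} on the left is the term of Δ(δ_{ab}) with index b⁻¹h.
  refine Fintype.sum_equiv (Equiv.mulLeft b⁻¹) _ _ fun h => ?_
  rw [assocHom_single, map_smul, TensorProduct.map_tmul, twistedMul_single, LinearMap.id_apply,
    TensorProduct.tmul_smul, smul_smul, smul_smul, Equiv.coe_mulLeft, mul_inv_rev, inv_inv,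
    mul_assoc a b, mul_inv_cancel_left]
  congr 1
  have := congrArg Units.val (ψ.coboundary (a * h) h⁻¹ b)
  simp only [Units.val_mul, mul_inv_cancel_right] at this
  simp only [Units.val_inv_eq_inv_val, Subgroup.coe_mul, InvMemClass.coe_inv] at this ⊢
  generalize (Fintype.card L : k)⁻¹ = c
  field_simp
  linear_combination c * this

theorem twistedComul_assoc [Fintype L] (ψ : Cochain2 ω L) :
    twistedComul ψ ≫ groupObj ω L ◁ twistedComul ψ =
      twistedComul ψ ≫ twistedComul ψ ▷ groupObj ω L ≫ (α_ _ _ _).hom := by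
  apply hom_ext
  ext a : 2
  change TensorProduct.map LinearMap.id (twistedComul ψ).hom
      ((twistedComul ψ).hom (Finsupp.single a 1)) =
    assocHom _ _ _ (TensorProduct.map (twistedComul ψ).hom LinearMap.id
      ((twistedComul ψ).hom (Finsupp.single a 1)))
  simp -dsimp only [map_smul, twistedComul_single, TensorProduct.tmul_smul, TensorProduct.tmul_sum,
    TensorProduct.sum_tmul, map_sum, assocHom_single, TensorProduct.map_tmul,
    ← TensorProduct.smul_tmul', smul_smul, LinearMap.id_apply, Finset.smul_sum]
  -- The term δ_{aji} ⊗ δ_{i⁻¹} ⊗ δ_{j⁻¹} on the right has first index ji and second index j on the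
  -- left, hence the exchange of sums and the substitution i ↦ ji.
  rw [Finset.sum_comm]
  refine Finset.sum_congr rfl fun j _ => ?_
  refine (Fintype.sum_equiv (Equiv.mulLeft j) _ _ fun i => ?_).symm
  rw [assocHom_single, smul_smul, Equiv.coe_mulLeft, mul_inv_rev, inv_mul_cancel_right,
    ← mul_assoc a j i]
  congr 1
  have := congrArg Units.val (ψ.coboundary (a * j * i) i⁻¹ j⁻¹)
  simp only [Units.val_mul, mul_inv_cancel_right] at this
  simp only [Units.val_inv_eq_inv_val, Subgroup.coe_mul, InvMemClass.coe_inv] at this ⊢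
  generalize (Fintype.card L : k)⁻¹ = c
  field_simp
  linear_combination c ^ 2 * this

theorem twistedCounit_comul [Fintype L] (hL : (Fintype.card L : k) ≠ 0) (ψ : Cochain2 ω L) :
    twistedComul ψ ≫ twistedCounit ω L ▷ groupObj ω L = (λ_ (groupObj ω L)).inv := by
  apply hom_ext
  ext a : 2
  change TensorProduct.map (twistedCounit ω L).hom LinearMap.id
      ((twistedComul ψ).hom (Finsupp.single a 1)) =
    (1 : k) ⊗ₜ[k] (Finsupp.single a 1)
  simp -dsimp only [twistedComul_single, map_smul, map_sum, TensorProduct.map_tmul, twistedCounit_single,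
    LinearMap.id_apply]
  -- The counit sees only the term with a h = e.
  rw [Finset.sum_eq_single a⁻¹]
  · rw [mul_inv_cancel, if_pos rfl, ψ.one_left, inv_one, Units.val_one, one_smul, inv_inv,
      TensorProduct.smul_tmul', smul_eq_mul, inv_mul_cancel₀ hL]
  · intro b _ hb
    rw [if_neg (fun h => hb (eq_inv_of_mul_eq_one_right h)), TensorProduct.zero_tmul, smul_zero]
  · simp

theorem twistedComul_counit [Fintype L] (hL : (Fintype.card L : k) ≠ 0) (ψ : Cochain2 ω L) :
    twistedComul ψ ≫ groupObj ω L ◁ twistedCounit ω L = (ρ_ (groupObj ω L)).inv := by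
  apply hom_ext
  ext a : 2
  change TensorProduct.map LinearMap.id (twistedCounit ω L).hom
      ((twistedComul ψ).hom (Finsupp.single a 1)) =
    (Finsupp.single a 1) ⊗ₜ[k] (1 : k)
  simp -dsimp only [twistedComul_single, map_smul, map_sum, TensorProduct.map_tmul, twistedCounit_single,
    LinearMap.id_apply]
  rw [Finset.sum_eq_single 1]
  · rw [inv_one, mul_one, if_pos rfl, ψ.one_right, inv_one, Units.val_one, one_smul,
      ← TensorProduct.tmul_smul, smul_eq_mul, inv_mul_cancel₀ hL]
  · intro b _ hb
    rw [if_neg (by simpa using hb), TensorProduct.tmul_zero, smul_zero]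
  · simp

/-- Each of the |L| summands multiplies back to δ_a, the values of ψ cancelling, and the prefactor
averages them. This is why the unscaled comultiplication of A(K, β) can serve in the oplax
structure. -/
theorem twistedComul_mul [Fintype L] (hL : (Fintype.card L : k) ≠ 0) (ψ : Cochain2 ω L) :
    twistedComul ψ ≫ twistedMul ψ = 𝟙 _ := by
  apply hom_ext
  ext a : 2
  change (twistedMul ψ).hom ((twistedComul ψ).hom (Finsupp.single a 1)) = Finsupp.single a 1
  rw [twistedComul_single, map_smul, map_sum]
  have h : ∀ h : L, (twistedMul ψ).hom ((((ψ (a * h) h⁻¹)⁻¹ : kˣ) : k) •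
      (Finsupp.single (a * h) (1 : k) ⊗ₜ[k] Finsupp.single h⁻¹ (1 : k))) =
        Finsupp.single a (1 : k) := fun h => by
    rw [map_smul, twistedMul_single, smul_smul, Units.inv_mul, one_smul, mul_inv_cancel_right]
  rw [Finset.sum_congr rfl fun x _ => h x, Finset.sum_const, Finset.card_univ,
    ← Nat.cast_smul_eq_nsmul k, smul_smul, inv_mul_cancel₀ hL, one_smul]

/-- The Frobenius algebra `A(L, ψ)`. -/
@[reducible]
noncomputable def twistedFrobeniusObj [Fintype L] (hL : (Fintype.card L : k) ≠ 0) (ψ : Cochain2 ω L) :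
    FrobeniusObj (groupObj ω L) where
  toMonObj := (twistedGroupAlgebra ψ).mon
  comul := twistedComul ψ
  counit := twistedCounit ω L
  counit_comul := twistedCounit_comul hL ψ
  comul_counit := twistedComul_counit hL ψ
  comul_assoc := twistedComul_assoc ψ
  frobenius_left := twistedComul_frobenius_left ψ
  frobenius_right := twistedComul_frobenius_right ψ

end TwistedGroupAlgebra

/-! ### The twisted Hecke algebra -/

/-! ### Rescaled morphisms, and the (op)lax maps on homogeneous vectors -/

section Scalars

variable {k G : Type u} [Field k] [Group G] [Fintype G] [DecidableEq G] {ω : Cocycle3 k G}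

/-- The multiple `c • f` of a morphism of graded vector spaces. -/
@[simps]
def smulHom (c : k) {X Y : Vec ω} (f : X ⟶ Y) : X ⟶ Y where
  hom := c • f.hom
  comm g := by rw [LinearMap.smul_comp, LinearMap.comp_smul, f.comm]

theorem smulHom_comp (c : k) {X Y Z : Vec ω} (f : X ⟶ Y) (g : Y ⟶ Z) :
    smulHom c f ≫ g = smulHom c (f ≫ g) :=
  hom_ext (LinearMap.comp_smul _ _ _)

theorem comp_smulHom (c : k) {X Y Z : Vec ω} (f : X ⟶ Y) (g : Y ⟶ Z) :
    f ≫ smulHom c g = smulHom c (f ≫ g) :=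
  hom_ext (LinearMap.smul_comp _ _ _)

theorem whiskerLeft_smulHom (c : k) (X : Vec ω) {Y Z : Vec ω} (f : Y ⟶ Z) :
    X ◁ smulHom c f = smulHom c (X ◁ f) :=
  hom_ext (TensorProduct.map_smul_right _ _ _)

theorem smulHom_whiskerRight (c : k) {Y Z : Vec ω} (f : Y ⟶ Z) (X : Vec ω) :
    smulHom c f ▷ X = smulHom c (f ▷ X) :=
  hom_ext (TensorProduct.map_smul_left _ _ _)

theorem smulHom_smulHom (c d : k) {X Y : Vec ω} (f : X ⟶ Y) :
    smulHom c (smulHom d f) = smulHom (c * d) f :=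
  hom_ext (smul_smul _ _ _)

theorem one_smulHom {X Y : Vec ω} (f : X ⟶ Y) : smulHom (1 : k) f = f :=
  hom_ext (one_smul _ _)

theorem freeLaxLift_smulHom (A : Mon (Vec ω)) (c : k) (e : A.X ⟶ 𝟙_ (Vec ω)) (X Y : Vec ω) :
    freeLaxLift A (smulHom c e) X Y = smulHom c (freeLaxLift A e X Y) := by
  simp only [freeLaxLift, comp_smulHom, smulHom_comp, whiskerLeft_smulHom, smulHom_whiskerRight]

theorem freeLaxUnit_smulHom (A : Mon (Vec ω)) (c : k) (d : A.X ⟶ A.X ⊗ A.X) :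
    freeLaxUnit A (smulHom c d) = smulHom c (freeLaxUnit A d) :=
  smulHom_comp _ _ _

/-- The four values of ω come from the four associators of `freeLaxLift`, in order. The last one has
degrees p, q, q' because the inner copies of A are gone by then. -/
theorem freeLaxLift_apply (A : Mon (Vec ω)) (e : A.X ⟶ 𝟙_ (Vec ω)) {X Y : Vec ω}
    {p q r p' q' r' : G} {a b a' b' : A.X.V} {x : X.V} {y : Y.V}
    (ha : A.X.Homog p a) (hx : X.Homog q x) (hb : A.X.Homog r b)
    (ha' : A.X.Homog p' a') (hy : Y.Homog q' y) (hb' : A.X.Homog r' b') (c : k)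
    (hc : e.hom (A.mon.mul.hom (b ⊗ₜ[k] a')) = c) :
    (freeLaxLift A e X Y).hom (((a ⊗ₜ[k] x) ⊗ₜ[k] b) ⊗ₜ[k] ((a' ⊗ₜ[k] y) ⊗ₜ[k] b')) =
      ((ω (p * q * r) (p' * q') r' * (ω (p * q) r (p' * q'))⁻¹ * ω r p' q' * (ω p q q')⁻¹ : kˣ) *
        c : k) • ((a ⊗ₜ[k] (x ⊗ₜ[k] y)) ⊗ₜ[k] b') := by
  -- The composite is written on plain tensor products with an arbitrary linear contraction `m`; it
  -- unfolds definitionally to `freeLaxLift`.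
  have key (m : A.X.V ⊗[k] A.X.V →ₗ[k] k) (h : m (b ⊗ₜ[k] a') = c) :
    TensorProduct.map (assocHom A.X X Y) LinearMap.id
    (TensorProduct.map (TensorProduct.map LinearMap.id (TensorProduct.lid k Y.V).toLinearMap)
      LinearMap.id
    (TensorProduct.map (TensorProduct.map LinearMap.id
      (TensorProduct.map m LinearMap.id))
      LinearMap.id
    (TensorProduct.map (TensorProduct.map LinearMap.id (assocInv A.X A.X Y)) LinearMap.id
    (TensorProduct.map (assocHom (tens A.X X) A.X (tens A.X Y)) LinearMap.id
    (assocInv (tens (tens A.X X) A.X) (tens A.X Y) A.X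
      (((a ⊗ₜ[k] x) ⊗ₜ[k] b) ⊗ₜ[k] ((a' ⊗ₜ[k] y) ⊗ₜ[k] b'))))))) =
      ((ω (p * q * r) (p' * q') r' * (ω (p * q) r (p' * q'))⁻¹ * ω r p' q' * (ω p q q')⁻¹ : kˣ) *
        c : k) • ((a ⊗ₜ[k] (x ⊗ₜ[k] y)) ⊗ₜ[k] b') := by
    simp -dsimp only [assocInv_apply ((ha.tmul hx).tmul hb) (ha'.tmul hy) hb', map_smul,
      TensorProduct.map_tmul, assocHom_apply (ha.tmul hx) hb (ha'.tmul hy),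
      ← TensorProduct.smul_tmul', assocInv_apply hb ha' hy, TensorProduct.tmul_smul, h,
      LinearMap.id_apply, LinearEquiv.coe_coe, TensorProduct.lid_tmul, assocHom_apply ha hx hy,
      smul_smul, Units.val_mul]
    congr 1
    ring
  exact key (e.hom ∘ₗ A.mon.mul.hom) hc

/-- Once d(1) is written as a sum of homogeneous tensors, each associator acts on each term by a
scalar. -/
theorem freeOplaxLift_apply (A : Mon (Vec ω)) (d : A.X ⟶ A.X ⊗ A.X) {X Y : Vec ω}
    {p q q' r' : G} {a b' : A.X.V} {x : X.V} {y : Y.V}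
    (ha : A.X.Homog p a) (hx : X.Homog q x) (hy : Y.Homog q' y) (hb' : A.X.Homog r' b')
    {ι : Type*} (t : Finset ι) (c : ι → k) (r p' : ι → G) (b a' : ι → A.X.V)
    (hb : ∀ i, A.X.Homog (r i) (b i)) (ha' : ∀ i, A.X.Homog (p' i) (a' i))
    (hd : d.hom (A.mon.one.hom (1 : k)) = ∑ i ∈ t, c i • (b i ⊗ₜ[k] a' i)) :
    (freeOplaxLift A d X Y).hom ((a ⊗ₜ[k] (x ⊗ₜ[k] y)) ⊗ₜ[k] b') =
      ∑ i ∈ t, ((ω p q q' * ω (p * q) (r i) (p' i * q') * (ω (p * q * r i) (p' i * q') r')⁻¹ *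
        (ω (r i) (p' i) q')⁻¹ : kˣ) * c i : k) •
        (((a ⊗ₜ[k] x) ⊗ₜ[k] b i) ⊗ₜ[k] ((a' i ⊗ₜ[k] y) ⊗ₜ[k] b')) := by
  have key (m : k →ₗ[k] A.X.V ⊗[k] A.X.V) (h : m 1 = ∑ i ∈ t, c i • (b i ⊗ₜ[k] a' i)) :
    assocHom (tens (tens A.X X) A.X) (tens A.X Y) A.X
    (TensorProduct.map (assocInv (tens A.X X) A.X (tens A.X Y)) LinearMap.id
    (TensorProduct.map (TensorProduct.map LinearMap.id (assocHom A.X A.X Y)) LinearMap.id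
    (TensorProduct.map (TensorProduct.map LinearMap.id
      (TensorProduct.map m LinearMap.id))
      LinearMap.id
    (TensorProduct.map (TensorProduct.map LinearMap.id (TensorProduct.lid k Y.V).symm.toLinearMap)
      LinearMap.id
    (TensorProduct.map (assocInv A.X X Y) LinearMap.id
      ((a ⊗ₜ[k] (x ⊗ₜ[k] y)) ⊗ₜ[k] b')))))) =
      ∑ i ∈ t, ((ω p q q' * ω (p * q) (r i) (p' i * q') * (ω (p * q * r i) (p' i * q') r')⁻¹ *
        (ω (r i) (p' i) q')⁻¹ : kˣ) * c i : k) •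
        (((a ⊗ₜ[k] x) ⊗ₜ[k] b i) ⊗ₜ[k] ((a' i ⊗ₜ[k] y) ⊗ₜ[k] b')) := by
    simp -dsimp only [TensorProduct.map_tmul, assocInv_apply ha hx hy, map_smul,
      ← TensorProduct.smul_tmul', LinearMap.id_apply, LinearEquiv.coe_coe,
      TensorProduct.lid_symm_apply, h, TensorProduct.sum_tmul, TensorProduct.tmul_sum, map_sum,
      TensorProduct.tmul_smul, assocHom_apply (hb _) (ha' _) hy,
      assocInv_apply (ha.tmul hx) (hb _) ((ha' _).tmul hy),
      assocHom_apply ((ha.tmul hx).tmul (hb _)) ((ha' _).tmul hy) hb', Finset.smul_sum,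
      smul_smul, Units.val_mul]
    refine Finset.sum_congr rfl fun i _ => ?_
    congr 1
    ring
  exact key (d.hom ∘ₗ A.mon.one.hom) hd

theorem freeOplaxCounit_apply (A : Mon (Vec ω)) (a b : A.X.V) (c : k) :
    (freeOplaxCounit A).hom ((a ⊗ₜ[k] c) ⊗ₜ[k] b) = c • A.mon.mul.hom (a ⊗ₜ[k] b) := by
  change A.mon.mul.hom (TensorProduct.rid k A.X.V (a ⊗ₜ[k] c) ⊗ₜ[k] b) = _
  rw [TensorProduct.rid_tmul, ← TensorProduct.smul_tmul']
  exact map_smul _ _ _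

end Scalars

/-! ### The Frobenius data on the twisted Hecke algebra -/

section Hecke

variable {k G : Type u} [Field k] [Group G] [Fintype G] [DecidableEq G]
  {ω : Cocycle3 k G} {K L : Subgroup G} [Fintype K] [Fintype L]

theorem smulHom_twistedComul_frobenius_left (c : k) (β : Cochain2 ω K) :
    groupObj ω K ◁ smulHom c (twistedComul β) ≫ (α_ _ _ _).inv ≫ twistedMul β ▷ groupObj ω K =
      twistedMul β ≫ smulHom c (twistedComul β) := by
  rw [whiskerLeft_smulHom, smulHom_comp, comp_smulHom, twistedComul_frobenius_left]

theorem smulHom_twistedComul_frobenius_right (c : k) (β : Cochain2 ω K) :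
    smulHom c (twistedComul β) ▷ groupObj ω K ≫ (α_ _ _ _).hom ≫ groupObj ω K ◁ twistedMul β =
      twistedMul β ≫ smulHom c (twistedComul β) := by
  rw [smulHom_whiskerRight, smulHom_comp, comp_smulHom, twistedComul_frobenius_right]

/-- The counit laws are bilinear in (Δ, ε), so opposite scalings cancel. -/
theorem smulHom_twistedCounit_comul (hK : (Fintype.card K : k) ≠ 0) {c : k} (hc : c ≠ 0)
    (β : Cochain2 ω K) :
    smulHom c (twistedComul β) ≫ smulHom c⁻¹ (twistedCounit ω K) ▷ groupObj ω K =
      (λ_ (groupObj ω K)).inv := by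
  rw [smulHom_whiskerRight, smulHom_comp, comp_smulHom, smulHom_smulHom, mul_inv_cancel₀ hc,
    one_smulHom, twistedCounit_comul hK]

theorem smulHom_twistedComul_counit (hK : (Fintype.card K : k) ≠ 0) {c : k} (hc : c ≠ 0)
    (β : Cochain2 ω K) :
    smulHom c (twistedComul β) ≫ groupObj ω K ◁ smulHom c⁻¹ (twistedCounit ω K) =
      (ρ_ (groupObj ω K)).inv := by
  rw [whiskerLeft_smulHom, smulHom_comp, comp_smulHom, smulHom_smulHom, mul_inv_cancel₀ hc,
    one_smulHom, twistedComul_counit hK]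

theorem twistedOne_comul_mul (hK : (Fintype.card K : k) ≠ 0) (β : Cochain2 ω K) :
    twistedOne ω K ≫ twistedComul β ≫ twistedMul β = twistedOne ω K := by
  rw [twistedComul_mul hK, Category.comp_id]

/-- The morphisms inducing the Frobenius structure of the twisted Hecke algebra. -/
noncomputable def heckeData (hK : (Fintype.card K : k) ≠ 0) (hL : (Fintype.card L : k) ≠ 0)
    (β : Cochain2 ω K) (ψ : Cochain2 ω L) : FrobeniusBimodData (hecke β ψ) :=
  letI := twistedFrobeniusObj hL ψ
  freeFrobeniusBimodData (twistedGroupAlgebra β)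
    -- The lax structure uses the rescaled pair with c = |K|, while the oplax one uses the unscaled
    -- comultiplication. In the counit laws `hK` appears twice: once for the law itself and once for
    -- c ≠ 0.
    (smulHom (Fintype.card K : k)⁻¹ (twistedCounit ω K))
    (smulHom (Fintype.card K : k) (twistedComul β)) (twistedComul β)
    (smulHom_twistedComul_frobenius_left _ β) (smulHom_twistedComul_frobenius_right _ β)
    (smulHom_twistedCounit_comul hK hK β) (smulHom_twistedComul_counit hK hK β)
    (twistedOne_comul_mul hK β) (groupObj ω L)

theorem heckeData_mul (hK : (Fintype.card K : k) ≠ 0) (hL : (Fintype.card L : k) ≠ 0)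
    (β : Cochain2 ω K) (ψ : Cochain2 ω L) :
    (heckeData hK hL β ψ).mul = smulHom (Fintype.card K : k)⁻¹
      (freeLaxLift (twistedGroupAlgebra β) (twistedCounit ω K) (groupObj ω L) (groupObj ω L) ≫
        ((Φ β).map (twistedMul ψ)).hom) :=
  (congrArg (· ≫ ((Φ β).map (twistedMul ψ)).hom)
    (freeLaxLift_smulHom (twistedGroupAlgebra β) _ (twistedCounit ω K) _ _)).trans
    (smulHom_comp _ _ _)

theorem heckeData_one (hK : (Fintype.card K : k) ≠ 0) (hL : (Fintype.card L : k) ≠ 0)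
    (β : Cochain2 ω K) (ψ : Cochain2 ω L) :
    (heckeData hK hL β ψ).one = smulHom (Fintype.card K : k)
      (freeLaxUnit (twistedGroupAlgebra β) (twistedComul β) ≫
        ((Φ β).map (twistedOne ω L)).hom) :=
  (congrArg (· ≫ ((Φ β).map (twistedOne ω L)).hom)
    (freeLaxUnit_smulHom (twistedGroupAlgebra β) _ (twistedComul β))).trans
    (smulHom_comp _ _ _)

end Hecke

/-! ### Values of the structure morphisms on basis vectors, and the direct sum decomposition -/

section HeckeFormulas

variable {k G : Type u} [Field k] [Group G] [Fintype G] [DecidableEq G]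
  {ω : Cocycle3 k G} {K L : Subgroup G} [Fintype K] [Fintype L]

theorem homog_groupObj (N : Subgroup G) (a : N) :
    (groupObj ω N).Homog (a : G) (Finsupp.single a (1 : k)) :=
  homog_single _ a 1

theorem heckeData_mul_apply (hK : (Fintype.card K : k) ≠ 0) (hL : (Fintype.card L : k) ≠ 0)
    (β : Cochain2 ω K) (ψ : Cochain2 ω L) (f : K) (g : L) (s f' : K) (g' : L) (s' : K) :
    (heckeData hK hL β ψ).mul.hom (heckeVec β ψ f g s ⊗ₜ[k] heckeVec β ψ f' g' s') =
      if s * f' = 1 then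
        ((ω (f * g * s : G) (f' * g' : G) s' * (ω (f * g : G) s (f' * g' : G))⁻¹ *
          ω s f' g' * (ω f g g')⁻¹ * β s f' * ψ g g' : kˣ) : k) • heckeVec β ψ f (g * g') s'
      else 0 := by
  have hc : (twistedCounit ω K).hom ((twistedMul β).hom
      (Finsupp.single s (1 : k) ⊗ₜ[k] Finsupp.single f' (1 : k))) =
        (β s f' : k) * (if s * f' = 1 then (Fintype.card K : k) else 0) := by
    rw [twistedMul_single, map_smul, twistedCounit_single]
    rfl
  have h1 := freeLaxLift_apply (twistedGroupAlgebra β) (twistedCounit ω K)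
    (homog_groupObj K f) (homog_groupObj L g) (homog_groupObj K s) (homog_groupObj K f')
    (homog_groupObj L g') (homog_groupObj K s') _ hc
  -- `m` stands for Φ(m_B), and `c` for the product of the four values of ω.
  have key (m : ((K →₀ k) ⊗[k] ((L →₀ k) ⊗[k] (L →₀ k))) ⊗[k] (K →₀ k) →ₗ[k]
      ((K →₀ k) ⊗[k] (L →₀ k)) ⊗[k] (K →₀ k))
      (hm : m = TensorProduct.map (TensorProduct.map LinearMap.id (twistedMul ψ).hom) LinearMap.id)
      (c : k) :
      (Fintype.card K : k)⁻¹ • m ((c * ((β s f' : k) *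
        (if s * f' = 1 then (Fintype.card K : k) else 0))) • ((Finsupp.single f (1 : k) ⊗ₜ[k]
          (Finsupp.single g (1 : k) ⊗ₜ[k] Finsupp.single g' (1 : k))) ⊗ₜ[k]
            Finsupp.single s' (1 : k))) =
      if s * f' = 1 then (c * β s f' * ψ g g') • ((Finsupp.single f (1 : k) ⊗ₜ[k]
          Finsupp.single (g * g') (1 : k)) ⊗ₜ[k] Finsupp.single s' (1 : k)) else 0 := by
    rw [map_smul, hm, TensorProduct.map_tmul, TensorProduct.map_tmul, twistedMul_single,
      TensorProduct.tmul_smul, ← TensorProduct.smul_tmul', smul_smul, smul_smul]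
    split_ifs
    -- The |K| of the counit cancels the normalization |K|⁻¹.
    · congr 1
      field_simp
    · simp
  rw [heckeData_mul, smulHom_hom]
  refine (congrArg (fun v => (Fintype.card K : k)⁻¹ • ((Φ β).map (twistedMul ψ)).hom.hom v)
    h1).trans ?_
  simp only [Units.val_mul] at key ⊢
  exact key _ rfl _

theorem heckeData_one_apply (hK : (Fintype.card K : k) ≠ 0) (hL : (Fintype.card L : k) ≠ 0)
    (β : Cochain2 ω K) (ψ : Cochain2 ω L) (d : K) :
    (heckeData hK hL β ψ).one.hom (unitVec β d) =
      ∑ s : K, (((β (d * s⁻¹) s)⁻¹ : kˣ) : k) • heckeVec β ψ (d * s⁻¹) 1 s := by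
  have key {N : Type u} [AddCommGroup N] [Module k N] (m : (K →₀ k) ⊗[k] (K →₀ k) →ₗ[k] N) :
      (Fintype.card K : k) • m ((twistedComul β).hom (Finsupp.single d (1 : k))) =
        ∑ s : K, (((β (d * s⁻¹) s)⁻¹ : kˣ) : k) •
          m (Finsupp.single (d * s⁻¹) (1 : k) ⊗ₜ[k] Finsupp.single s (1 : k)) := by
    rw [twistedComul_single, map_smul, smul_smul, mul_inv_cancel₀ hK, one_smul, map_sum]
    -- The sum is indexed by the degree s = h⁻¹ of the second leg.
    refine Fintype.sum_equiv (Equiv.inv K) _ _ fun h => ?_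
    rw [map_smul, Equiv.inv_apply, inv_inv]
  rw [heckeData_one, smulHom_hom]
  exact key (((Φ β).map (twistedOne ω L)).hom.hom ∘ₗ
    ((ρ_ (groupObj ω K)).inv ▷ groupObj ω K).hom)

theorem smul_map_sum {M N : Type*} [AddCommGroup M] [Module k M] [AddCommGroup N] [Module k N]
    (φ : M →ₗ[k] N) {ι : Type*} (t : Finset ι) (c : k) (d : ι → k) (x : ι → M) :
    c • φ (∑ i ∈ t, d i • x i) = ∑ i ∈ t, (c * d i) • φ (x i) := by
  simp only [map_sum, map_smul, Finset.smul_sum, smul_smul]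

/-- The linear map π is left arbitrary so that the formula can be projected to the tensor product
over A without computing there. -/
theorem heckeData_comul_apply (hK : (Fintype.card K : k) ≠ 0) (hL : (Fintype.card L : k) ≠ 0)
    (β : Cochain2 ω K) (ψ : Cochain2 ω L) (f : K) (g : L) (s' : K) {N : Type u}
    [AddCommGroup N] [Module k N] (π : (hecke β ψ).X.V ⊗[k] (hecke β ψ).X.V →ₗ[k] N) :
    π ((heckeData hK hL β ψ).comul.hom (heckeVec β ψ f g s')) =
      ((Fintype.card K : k)⁻¹ * (Fintype.card L : k)⁻¹) • ∑ h : L, ∑ s : K,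
        ((ω f (g * h : G) (h⁻¹ : G) * ω (f * g * h : G) s (s⁻¹ * h⁻¹ : G) *
          (ω (f * g * h * s : G) (s⁻¹ * h⁻¹ : G) s')⁻¹ * (ω s (s⁻¹ : G) (h⁻¹ : G))⁻¹ *
          (ψ (g * h) h⁻¹)⁻¹ * (β s s⁻¹)⁻¹ : kˣ) : k) •
          π (heckeVec β ψ f (g * h) s ⊗ₜ[k] heckeVec β ψ s⁻¹ h⁻¹ s') := by
  have hd : (twistedComul β).hom ((twistedOne ω K).hom (1 : k)) = ∑ s : K,
      ((Fintype.card K : k)⁻¹ * (((β s s⁻¹)⁻¹ : kˣ) : k)) •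
        (Finsupp.single s (1 : k) ⊗ₜ[k] Finsupp.single s⁻¹ (1 : k)) := by
    refine (twistedComul_single β 1).trans ?_
    rw [Finset.smul_sum]
    refine Finset.sum_congr rfl fun s _ => ?_
    rw [one_mul, smul_smul]
  have h1 (h : L) := freeOplaxLift_apply (twistedGroupAlgebra β) (twistedComul β)
    (homog_groupObj K f) (homog_groupObj L (g * h)) (homog_groupObj L h⁻¹) (homog_groupObj K s')
    Finset.univ _ (fun s : K => (s : G)) (fun s : K => ((s⁻¹ : K) : G)) _ _
    (fun s => homog_groupObj K s) (fun s => homog_groupObj K s⁻¹) hd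
  have key (m : ((K →₀ k) ⊗[k] ((L →₀ k) ⊗[k] (L →₀ k))) ⊗[k] (K →₀ k) →ₗ[k] N) :
      m ((Finsupp.single f (1 : k) ⊗ₜ[k] (twistedComul ψ).hom (Finsupp.single g (1 : k))) ⊗ₜ[k]
        Finsupp.single s' (1 : k)) =
      (Fintype.card L : k)⁻¹ • ∑ h : L, (((ψ (g * h) h⁻¹)⁻¹ : kˣ) : k) •
        m ((Finsupp.single f (1 : k) ⊗ₜ[k] (Finsupp.single (g * h) (1 : k) ⊗ₜ[k]
          Finsupp.single h⁻¹ (1 : k))) ⊗ₜ[k] Finsupp.single s' (1 : k)) := by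
    rw [twistedComul_single, TensorProduct.tmul_smul, ← TensorProduct.smul_tmul', map_smul,
      TensorProduct.tmul_sum, TensorProduct.sum_tmul, map_sum]
    congr 1
    refine Finset.sum_congr rfl fun h _ => ?_
    rw [TensorProduct.tmul_smul, ← TensorProduct.smul_tmul', map_smul]
  refine (key (π ∘ₗ (freeOplaxLift (twistedGroupAlgebra β) (twistedComul β) (groupObj ω L)
    (groupObj ω L)).hom)).trans ?_
  -- The factor |L|⁻¹ comes from Δ_B and is removed first; |K|⁻¹ comes from Δ_A u_A, inside the sum
  -- over h.
  rw [mul_comm (Fintype.card K : k)⁻¹, ← smul_smul]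
  congr 1
  rw [Finset.smul_sum]
  refine Finset.sum_congr rfl fun h _ => ?_
  refine (congrArg (fun v => (((ψ (g * h) h⁻¹)⁻¹ : kˣ) : k) • π v) (h1 h)).trans ?_
  refine (smul_map_sum π _ _ _ _).trans ?_
  rw [Finset.smul_sum]
  refine Finset.sum_congr rfl fun s _ => ?_
  rw [smul_smul]
  simp only [Units.val_mul, Subgroup.coe_mul, InvMemClass.coe_inv, ← mul_assoc (f : G)]
  refine congrArg (· • _) ?_
  ring

theorem heckeData_counit_apply (hK : (Fintype.card K : k) ≠ 0) (hL : (Fintype.card L : k) ≠ 0)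
    (β : Cochain2 ω K) (ψ : Cochain2 ω L) (f : K) (g : L) (s : K) :
    (heckeData hK hL β ψ).counit.hom (heckeVec β ψ f g s) =
      if g = 1 then ((Fintype.card L : k) * β f s) • unitVec β (f * s) else 0 := by
  have h1 := freeOplaxCounit_apply (twistedGroupAlgebra β) (Finsupp.single f (1 : k))
    (Finsupp.single s (1 : k)) ((twistedCounit ω L).hom (Finsupp.single g (1 : k)))
  refine h1.trans ?_
  refine (congrArg₂ (· • ·) (twistedCounit_single g) (twistedMul_single β f s)).trans ?_
  split_ifs
  · exact smul_smul _ _ _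
  · exact zero_smul _ _

/-- The linear map out of a triple tensor product of free modules which has prescribed values on
the basis. -/
noncomputable def tripleLinearCombination {S T U : Type*} {N : Type*} [AddCommGroup N] [Module k N]
    (w : S → T → U → N) : ((S →₀ k) ⊗[k] (T →₀ k)) ⊗[k] (U →₀ k) →ₗ[k] N :=
  TensorProduct.lift (TensorProduct.lift (Finsupp.linearCombination k fun s =>
    Finsupp.linearCombination k fun t => Finsupp.linearCombination k fun v => w s t v))

theorem tripleLinearCombination_single {S T U : Type*} {N : Type*} [AddCommGroup N] [Module k N]
    (w : S → T → U → N) (s : S) (t : T) (v : U) :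
    tripleLinearCombination w
      ((Finsupp.single s (1 : k) ⊗ₜ[k] Finsupp.single t (1 : k)) ⊗ₜ[k] Finsupp.single v (1 : k)) =
      w s t v := by
  simp [tripleLinearCombination]

/-- The morphism out of a triple tensor product of direct sums of one-dimensional objects which
has prescribed values on the basis. -/
@[simps]
noncomputable def ofDegreesDesc {S T U : Type u} [Finite S] [Finite T] [Finite U] {d : S → G}
    {d' : T → G} {d'' : U → G} {Z : Vec ω} (w : S → T → U → Z.V)
    (hw : ∀ s t v, Z.Homog (d s * d' t * d'' v) (w s t v)) :
    tens (tens (ofDegrees ω d) (ofDegrees ω d')) (ofDegrees ω d'') ⟶ Z where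
  hom := tripleLinearCombination w
  comm a := by
    apply ext_single₃
    intro s t v
    have h := ((homog_single (ω := ω) d s 1).tmul (homog_single (ω := ω) d' t 1)).tmul
      (homog_single (ω := ω) d'' v 1)
    rw [LinearMap.comp_apply, LinearMap.comp_apply, h.proj_eq, tripleLinearCombination_single,
      (hw s t v).proj_eq]
    split_ifs
    · exact tripleLinearCombination_single w s t v
    · exact map_zero _

theorem hecke_hom_ext {β : Cochain2 ω K} {ψ : Cochain2 ω L} {Z : Vec ω} {φ φ' : (hecke β ψ).X ⟶ Z}
    (h : ∀ f g s, φ.hom (heckeVec β ψ f g s) = φ'.hom (heckeVec β ψ f g s)) : φ = φ' :=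
  hom_ext (ext_single₃ h)

/-- The morphism out of the twisted Hecke algebra with prescribed values on the basis. -/
noncomputable def heckeDesc (β : Cochain2 ω K) (ψ : Cochain2 ω L) {Z : Vec ω}
    (w : K → L → K → Z.V) (hw : ∀ (f : K) (g : L) (s : K), Z.Homog ((f : G) * g * s) (w f g s)) :
    (hecke β ψ).X ⟶ Z :=
  ofDegreesDesc (ω := ω) (d := fun x : K => (x : G)) (d' := fun x : L => (x : G))
    (d'' := fun x : K => (x : G)) w hw

theorem heckeDesc_heckeVec (β : Cochain2 ω K) (ψ : Cochain2 ω L) {Z : Vec ω}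
    (w : K → L → K → Z.V) (hw : ∀ (f : K) (g : L) (s : K), Z.Homog ((f : G) * g * s) (w f g s))
    (f : K) (g : L) (s : K) :
    (heckeDesc β ψ w hw).hom (heckeVec β ψ f g s) = w f g s :=
  tripleLinearCombination_single w f g s

/-- The basis vector of `(δ_a ⊗ δ_b) ⊗ δ_c`. -/
def δVec (ω : Cocycle3 k G) (a b c : G) : ((δ ω a ⊗ δ ω b) ⊗ δ ω c : Vec ω).V :=
  ((1 ⊗ₜ[k] 1) ⊗ₜ[k] 1 : (k ⊗[k] k) ⊗[k] k)

theorem homog_δVec (a b c : G) :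
    Homog ((δ ω a ⊗ δ ω b) ⊗ δ ω c) (a * b * c) (δVec ω a b c) :=
  ((homog_δ ω _ 1).tmul (homog_δ ω _ 1)).tmul (homog_δ ω _ 1)

theorem δVec_hom_ext {a b c : G} {Z : Vec ω} {φ φ' : (δ ω a ⊗ δ ω b) ⊗ δ ω c ⟶ Z}
    (h : φ.hom (δVec ω a b c) = φ'.hom (δVec ω a b c)) : φ = φ' := by
  have key (m m' : (k ⊗[k] k) ⊗[k] k →ₗ[k] Z.V)
      (hm : m ((1 ⊗ₜ[k] 1) ⊗ₜ[k] 1) = m' ((1 ⊗ₜ[k] 1) ⊗ₜ[k] 1)) : m = m' := by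
    ext
    exact hm
  exact hom_ext (key _ _ h)

theorem heckeι_δVec (β : Cochain2 ω K) (ψ : Cochain2 ω L) (f : K) (g : L) (h : K) :
    (heckeι β ψ f g h).hom (δVec ω f g h) = heckeVec β ψ f g h :=
  rfl

/-- The underlying object of the twisted Hecke algebra is the direct sum of the objects
`(δ_f ⊗ δ_g) ⊗ δ_h`. -/
noncomputable def heckeIsColimit (β : Cochain2 ω K) (ψ : Cochain2 ω L) :
    IsColimit (Cofan.mk (hecke β ψ).X (fun i : K × L × K => heckeι β ψ i.1 i.2.1 i.2.2)) :=
  have hw (s : Cofan fun i : K × L × K => (δ ω (i.1 : G) ⊗ δ ω (i.2.1 : G)) ⊗ δ ω (i.2.2 : G))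
      (f : K) (g : L) (h : K) :
      s.pt.Homog ((f : G) * g * h) ((s.inj (f, g, h)).hom (δVec ω (f : G) g h)) :=
    (homog_δVec (f : G) g h).map (s.inj (f, g, h))
  Cofan.IsColimit.mk _
    -- Each summand is spanned by one homogeneous vector, so a cocone amounts to a choice of
    -- homogeneous images of the basis vectors.
    (fun s => heckeDesc β ψ (fun f g h => (s.inj (f, g, h)).hom (δVec ω (f : G) g h)) (hw s))
    (fun s j => by
      apply δVec_hom_ext
      exact (congrArg _ (heckeι_δVec β ψ j.1 j.2.1 j.2.2)).trans
        (heckeDesc_heckeVec β ψ _ (hw s) _ _ _))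
    (fun s m hm => hecke_hom_ext fun f g h => by
      rw [heckeDesc_heckeVec, ← hm (f, g, h), ← heckeι_δVec]
      rfl)

end HeckeFormulas

end TwistedHecke

open TwistedHecke
theorem theorem5p4 {𝕜 G : Type u} [Field 𝕜] [IsAlgClosed 𝕜] [CharZero 𝕜]
    [Group G] [Fintype G] [DecidableEq G] (ω : Cocycle3 𝕜 G)
    (K L : Subgroup G) [Fintype K] [Fintype L]
    (β : Cochain2 ω K) (ψ : Cochain2 ω L) :
    -- the underlying object is the direct sum of the `(δ_f ⊗ δ_g) ⊗ δ_k`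
    Nonempty (IsColimit (Cofan.mk (hecke β ψ).X
      (fun i : K × L × K => heckeι β ψ i.1 i.2.1 i.2.2))) ∧
    ∃ F : FrobeniusObj (hecke β ψ),
      -- multiplication
      (∀ (f : K) (g : L) (k f' : K) (g' : L) (k' : K),
        F.mul.hom.hom (tmulOver (heckeVec β ψ f g k) (heckeVec β ψ f' g' k')) =
          if k * f' = 1 then
            ((ω (f * g * k : G) (f' * g' : G) k' * (ω (f * g : G) k (f' * g' : G))⁻¹ *
              ω k f' g' * (ω f g g')⁻¹ * β k f' * ψ g g' : 𝕜ˣ) : 𝕜) •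
              heckeVec β ψ f (g * g') k'
          else 0) ∧
      -- unit
      (∀ d : K, F.one.hom.hom (unitVec β d) =
        ∑ s : K, (((β (d * s⁻¹) s)⁻¹ : 𝕜ˣ) : 𝕜) • heckeVec β ψ (d * s⁻¹) 1 s) ∧
      -- comultiplication
      (∀ (f : K) (g : L) (k : K), F.comul.hom.hom (heckeVec β ψ f g k) =
        ((Fintype.card K : 𝕜)⁻¹ * (Fintype.card L : 𝕜)⁻¹) • ∑ h : L, ∑ s : K,
          ((ω f (g * h : G) (h⁻¹ : G) * ω (f * g * h : G) s (s⁻¹ * h⁻¹ : G) *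
            (ω (f * g * h * s : G) (s⁻¹ * h⁻¹ : G) k)⁻¹ * (ω s (s⁻¹ : G) (h⁻¹ : G))⁻¹ *
            (ψ (g * h) h⁻¹)⁻¹ * (β s s⁻¹)⁻¹ : 𝕜ˣ) : 𝕜) •
            tmulOver (heckeVec β ψ f (g * h) s) (heckeVec β ψ s⁻¹ h⁻¹ k)) ∧
      -- counit
      (∀ (f : K) (g : L) (k : K), F.counit.hom.hom (heckeVec β ψ f g k) =
        if g = 1 then ((Fintype.card L : 𝕜) * β f k) • unitVec β (f * k) else 0) ∧
      -- comparison with the maps induced by `Φ` from the structure of `A(K, β)` and `A(L, ψ)`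
      (tensorπ (hecke β ψ) (hecke β ψ) ≫ F.mul.hom).hom = (Fintype.card K : 𝕜)⁻¹ •
        (freeLaxLift (twistedGroupAlgebra β) (twistedCounit ω K) (groupObj ω L) (groupObj ω L) ≫
          ((Φ β).map (twistedMul ψ)).hom).hom ∧
      F.one.hom.hom = (Fintype.card K : 𝕜) •
        (freeLaxUnit (twistedGroupAlgebra β) (twistedComul β) ≫
          ((Φ β).map (twistedOne ω L)).hom).hom ∧
      F.comul.hom = ((Φ β).map (twistedComul ψ)).hom ≫
        freeOplaxLift (twistedGroupAlgebra β) (twistedComul β) (groupObj ω L) (groupObj ω L) ≫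
          tensorπ (hecke β ψ) (hecke β ψ) ∧
      F.counit.hom = ((Φ β).map (twistedCounit ω L)).hom ≫
        freeOplaxCounit (twistedGroupAlgebra β) := by
  -- Characteristic 0 enters only through the invertibility of |K| and |L|.
  have hK : (Fintype.card K : 𝕜) ≠ 0 := Nat.cast_ne_zero.2 Fintype.card_ne_zero
  have hL : (Fintype.card L : 𝕜) ≠ 0 := Nat.cast_ne_zero.2 Fintype.card_ne_zero
  refine ⟨⟨heckeIsColimit β ψ⟩, (heckeData hK hL β ψ).frobeniusObj, ?_,
    heckeData_one_apply hK hL β ψ, fun f g s => heckeData_comul_apply hK hL β ψ f g s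
      (tensorπ (hecke β ψ) (hecke β ψ)).hom,
    heckeData_counit_apply hK hL β ψ, ?_, congrArg Vec.Hom.hom (heckeData_one hK hL β ψ),
    Category.assoc _ _ _, rfl⟩
  · intro f g s f' g' s'
    exact (LinearMap.congr_fun (congrArg Vec.Hom.hom (heckeData hK hL β ψ).tensorπ_mulHom)
      (heckeVec β ψ f g s ⊗ₜ[𝕜] heckeVec β ψ f' g' s')).trans
      (heckeData_mul_apply hK hL β ψ f g s f' g' s')
  · exact congrArg Vec.Hom.hom ((heckeData hK hL β ψ).tensorπ_mulHom.trans
      (heckeData_mul hK hL β ψ))
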